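/- Let $\mathcal M$ be the monoid of $2\times2$ integer matrices with nonzero determinant, let $\mathrm{M}^{\mathrm{Irr}}$ be the set of column vectors $\omega=(\omega_1,\omega_2)^{\mathrm T}\in\mathbb R^2$ whose entries are linearly independent over $\mathbb Q$ (with the Euclidean topology), and let $G=\mathrm{PGL}_2(\mathbb Q)$. Let $\mathcal A_0$ be the additive group of continuous functions $F:\mathrm{M}^{\mathrm{Irr}}\to\mathbb R$ with $F(\alpha\omega)=F(\omega)$ for all real $\alpha>0$; $\mathcal M$ acts on it by $(\gamma\star F)(\omega)=\mathrm{sgn}(\det\gamma)F(\gamma^{\mathrm T}\omega)$. Let $D_0$ be the additive group of maps $\nu:\mathbb Q^2/\mathbb Z^2\to\mathcal A_0$ such that $\nu(x)=\sum_{cy=x}\nu(y)$ for all $x\in\mathbb Q^2/\mathbb Z^2$ and all integers $c>0$ (sum over $y\in\mathbb Q^2/\mathbb Z^2$). The monoid $\mathcal M$ acts on $D_0$ by $(\gamma\cdot\nu)(x)=\gamma\star\sum_{y\gamma^{\mathrm T}=x}\nu(y)$; the action extends to $\mathrm{GL}_2(\mathbb Q)$ by $\gamma\cdot\nu:=(c\gamma)\cdot\nu$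 for any integer $c>0$ with $c\gamma\in\mathcal M$, and it induces an action of $G$ on the subgroup $\mathcal D_0\subset D_0$ of elements fixed by $-I_2$. Write $\nu(x,\omega)$ for $\nu(x)(\omega)$. For $y\in\mathbb R$ let $\{y\}=y-\lfloor y\rfloor$, $\bar B_2(y)=\{y\}^2-\{y\}+\tfrac16$, and $\bar B_1(y)=0$ if $y\in\mathbb Z$, $\bar B_1(y)=\{y\}-\tfrac12$ otherwise; let $\mathbf 1_{\mathbb Z}$ be the indicator function of $\mathbb Z$, and let $\langle y\rangle$ be the representative of $y$ modulo $\mathbb Z$ in $(0,1]$. For integers $a,c$ with $c\neq0$ and $x\in\mathbb R^2$ put $$S(a,c;x)=\sum_{m\in\mathbb Z/c\mathbb Z}\bar B_1\Big(x_1+(x_2+m)\frac ac\Big)\bar B_1\Big((x_2+m)\frac1c\Big).$$ For $\gamma=\begin{pmatrix}a&b\\c&d\end{pmatrix}\in\mathcal M$, $x\in\mathbb Q^2$, $\omega\in\mathrm{M}^{\mathrm{Irr}}$ and $\tau=\omega_2/\omega_1$, put $\mathfrak Z_0(\gamma)(x,\omega)=0$ if $c=0$, and otherwise $$\mathfrak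 Z_0(\gamma)(x,\omega)=\frac{\gcd(a,c)^2}{2c(a+c\tau)}\bar B_2\Big(\frac{c}{\gcd(a,c)}x_1-\frac{a}{\gcd(a,c)}x_2\Big)+\frac{a+c\tau}{2c}\bar B_2(x_2)+\mathrm{sgn}(c)S(-a,c;x)-\frac{\mathrm{sgn}(c(a+c\tau))}{4}\mathbf 1_{\mathbb Z}(x_1)\mathbf 1_{\mathbb Z}(x_2).$$ Theorem. This rule induces a function $\mathfrak Z_0:G\to\mathcal D_0$, which is an inhomogeneous 1-cocycle whose class in $H^1(G,\mathcal D_0)$ is nonzero. Furthermore, let $\mathcal Z_0:=\mathfrak Z_0\begin{pmatrix}0&-1\\1&0\end{pmatrix}$, $\gamma=\begin{pmatrix}a&b\\c&d\end{pmatrix}\in\mathcal M$, $x\in\mathbb Q^2$ and $\omega\in\mathrm{M}^{\mathrm{Irr}}$. (i) If $\omega_1,\omega_2>0$, then $$\mathcal Z_0(x,\omega)=\zeta_2(z,\omega,0)+\frac{\mathbf 1_{\mathbb Z}(x_1)}2\zeta(\langle x_2\rangle,0)+\frac{\mathbf 1_{\mathbb Z}(x_2)}2\zeta(\langle x_1\rangle,0),\qquad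 z=\langle x_1\rangle\omega_1+\langle x_2\rangle\omega_2,$$ where $\zeta(y,s)$ is the Hurwitz zeta function and $\zeta_2(z,\omega,s)$ is the Barnes double zeta function, that is, the meromorphic continuation to $\mathbb C$ (which exists and is holomorphic at $s=0$) of the series $\sum_{m,n\ge0}(z+m\omega_1+n\omega_2)^{-s}$, absolutely convergent for $\mathrm{Re}(s)>2$. (ii) If $c\neq0$, then $\mathfrak Z_0(\gamma)=\begin{pmatrix}1&a\\0&c\end{pmatrix}\cdot\mathcal Z_0$. (iii) Suppose that $\gamma\in\mathrm{SL}_2(\mathbb Z)$ and that there is $\alpha\in\mathbb R$ with $\gamma^{\mathrm T}\omega=\alpha\omega$ and $\alpha^{-1}v-v\in\mathbb Z\omega_1\oplus\mathbb Z\omega_2$, where $v=x_1\omega_1+x_2\omega_2$. Then, if $c\neq0$, $$\mathfrak Z_0(\gamma)(x,\omega)=\frac{a+d}{2c}\bar B_2(x_2)+\mathrm{sgn}(c)S(-a,c;x)-\frac{\mathrm{sgn}(c\alpha)}4\mathbf 1_{\mathbb Z}(x_1)\mathbf 1_{\mathbb Z}(x_2),$$ and in every case $\mathfrak Z_0(\gamma)(x,\omega)$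 is a rational number. -/

import Mathlib

open scoped Matrix

noncomputable section

namespace RademacherCocycle

/-- The monoid `𝓜` of integral `2 × 2` matrices of nonzero determinant. -/
def IntMat : Submonoid (Matrix (Fin 2) (Fin 2) ℤ) where
  carrier := {γ | γ.det ≠ 0}
  one_mem' := by simp
  mul_mem' := by
    intro a b ha hb
    simp only [Set.mem_ofPred_eq, Matrix.det_mul] at *
    exact mul_ne_zero ha hb

lemma IntMat.det_ne_zero (γ : IntMat) : γ.1.det ≠ 0 := γ.2

/-- Real column vectors with entries that are linearly independent over `ℚ`, with the topology
induced from `ℝ²`. -/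
abbrev IrrVec : Type := {ω : Fin 2 → ℝ // LinearIndependent ℚ ω}

/-- The group `ℚ²/ℤ²`, written as `(ℚ/ℤ)²`. -/
abbrev QZ2 : Type := Fin 2 → AddCircle (1 : ℚ)

/-- The projection `ℚ² → ℚ²/ℤ²`. -/
def toQZ2 (x : Fin 2 → ℚ) : QZ2 := fun i => ((x i : ℚ) : AddCircle (1 : ℚ))

/-- The map `y ↦ y γᵀ` on (row) vectors `y ∈ ℚ²/ℤ²`. -/
def rowMul (γ : Matrix (Fin 2) (Fin 2) ℤ) (y : QZ2) : QZ2 := fun i => ∑ j, γ i j • y j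

lemma rowMul_mul (γ δ : Matrix (Fin 2) (Fin 2) ℤ) (y : QZ2) :
    rowMul (γ * δ) y = rowMul γ (rowMul δ y) := by
  funext i
  simp only [rowMul, Matrix.mul_apply, Fin.sum_univ_two, smul_add, add_smul, mul_smul]
  abel

lemma rowMul_sub (γ : Matrix (Fin 2) (Fin 2) ℤ) (y z : QZ2) :
    rowMul γ (y - z) = rowMul γ y - rowMul γ z := by
  funext i
  simp only [rowMul, Fin.sum_univ_two, Pi.sub_apply, smul_sub]
  abel

lemma rowMul_scalar (c : ℤ) (y : QZ2) :
    rowMul !![c, 0; 0, c] y = c • y := by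
  funext i
  fin_cases i <;> simp [rowMul]

lemma smul_one_eq (c : ℤ) : c • (1 : Matrix (Fin 2) (Fin 2) ℤ) = !![c, 0; 0, c] := by
  ext i j
  fin_cases i <;> fin_cases j <;> simp

lemma finite_smul_eq_zero {n : ℤ} (hn : n ≠ 0) : {y : QZ2 | n • y = 0}.Finite := by
  have h : {u : AddCircle (1 : ℚ) | n • u = 0}.Finite := by
    refine (AddCircle.finite_torsion (1 : ℚ) (Int.natAbs_pos.mpr hn)).subset ?_
    intro u hu
    simp only [Set.mem_ofPred_eq] at *
    rcases Int.natAbs_eq n with h | h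
    · rw [h, natCast_zsmul] at hu; exact hu
    · rw [h, neg_smul, natCast_zsmul, neg_eq_zero] at hu; exact hu
  refine (Set.Finite.pi' fun _ : Fin 2 => h).subset ?_
  intro y hy i
  simpa using congrFun (show n • y = 0 from hy) i

lemma finite_fiber (γ : IntMat) (x : QZ2) : {y : QZ2 | rowMul γ.1 y = x}.Finite := by
  rcases Set.eq_empty_or_nonempty {y : QZ2 | rowMul γ.1 y = x} with h | ⟨y₀, hy₀⟩
  · rw [h]; exact Set.finite_empty
  refine ((finite_smul_eq_zero γ.2).image (fun z => z + y₀)).subset ?_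
  intro y hy
  refine ⟨y - y₀, ?_, by simp⟩
  have h0 : rowMul γ.1 (y - y₀) = 0 := by
    rw [rowMul_sub, show rowMul γ.1 y = x from hy, show rowMul γ.1 y₀ = x from hy₀, sub_self]
  have h1 : rowMul (γ.1.adjugate * γ.1) (y - y₀) = 0 := by
    rw [rowMul_mul, h0]; funext i; simp [rowMul]
  rwa [Matrix.adjugate_mul, smul_one_eq, rowMul_scalar] at h1

lemma IrrVec.scale_aux {α : ℝ} (hα : α ≠ 0) (ω : IrrVec) : LinearIndependent ℚ (α • ω.1) := by
  have h := ω.2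
  rw [Fintype.linearIndependent_iff] at h ⊢
  intro g hg
  apply h g
  simp only [Pi.smul_apply, smul_comm _ α, ← Finset.smul_sum] at hg
  exact (smul_eq_zero.mp hg).resolve_left hα

/-- The vector `α ω` for a nonzero real number `α`. -/
def IrrVec.scale {α : ℝ} (hα : α ≠ 0) (ω : IrrVec) : IrrVec := ⟨α • ω.1, IrrVec.scale_aux hα ω⟩

lemma IrrVec.transposeMul_aux (γ : IntMat) (ω : IrrVec) :
    LinearIndependent ℚ ((γ.1.map (Int.cast : ℤ → ℝ))ᵀ *ᵥ ω.1) := by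
  have h := ω.2
  rw [Fintype.linearIndependent_iff] at h ⊢
  intro g hg
  have key := h ((γ.1.map (Int.cast : ℤ → ℚ)) *ᵥ g) (by
    rw [← hg]
    simp only [Matrix.mulVec, dotProduct, Fin.sum_univ_two, Matrix.map_apply,
      Matrix.transpose_apply, Rat.smul_def]
    push_cast
    ring)
  have hdet : (γ.1.map (Int.cast : ℤ → ℚ)).det ≠ 0 := by
    rw [show (Int.cast : ℤ → ℚ) = Int.castRingHom ℚ from rfl, ← RingHom.mapMatrix_apply,
      ← RingHom.map_det]
    simpa using IntMat.det_ne_zero γ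
  have := Matrix.eq_zero_of_mulVec_eq_zero hdet (funext key)
  intro i
  simp [this]

/-- The vector `γᵀ ω` for `γ ∈ 𝓜`. -/
def IrrVec.transposeMul (γ : IntMat) (ω : IrrVec) : IrrVec :=
  ⟨(γ.1.map (Int.cast : ℤ → ℝ))ᵀ *ᵥ ω.1, IrrVec.transposeMul_aux γ ω⟩

lemma IrrVec.transposeMul_continuous (γ : IntMat) : Continuous (IrrVec.transposeMul γ) := by
  refine Continuous.subtype_mk ?_ _
  exact Continuous.matrix_mulVec continuous_const continuous_subtype_val

lemma IrrVec.transposeMul_mul (γ δ : IntMat) (ω : IrrVec) :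
    IrrVec.transposeMul (γ * δ) ω = IrrVec.transposeMul δ (IrrVec.transposeMul γ ω) := by
  apply Subtype.ext
  simp only [IrrVec.transposeMul, Matrix.mulVec_mulVec, ← Matrix.transpose_mul]
  congr 2
  exact map_mul (Int.castRingHom ℝ).mapMatrix γ.1 δ.1

lemma IrrVec.transposeMul_scale (γ : IntMat) {α : ℝ} (hα : α ≠ 0) (ω : IrrVec) :
    IrrVec.transposeMul γ (IrrVec.scale hα ω) = IrrVec.scale hα (IrrVec.transposeMul γ ω) := by
  apply Subtype.ext
  simp only [IrrVec.transposeMul, IrrVec.scale, Matrix.mulVec_smul]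

/-- The group `𝒜₀` of continuous real functions on `IrrVec` that are invariant under multiplication
of the argument by positive real numbers. -/
def A0 : AddSubgroup C(IrrVec, ℝ) where
  carrier := {F | ∀ (α : ℝ) (hα : 0 < α) (ω : IrrVec), F (IrrVec.scale hα.ne' ω) = F ω}
  zero_mem' := by intro α hα ω; rfl
  add_mem' := by
    intro F F' hF hF' α hα ω
    simp only [ContinuousMap.add_apply, hF α hα ω, hF' α hα ω]
  neg_mem' := by
    intro F hF α hα ω
    simp only [ContinuousMap.neg_apply, hF α hα ω]

/-- The action `(γ ⋆ F)(ω) = sgn(det γ) F(γᵀ ω)` of `𝓜` on `𝒜₀`. -/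
def starAct (γ : IntMat) : A0 →+ A0 where
  toFun F := ⟨γ.1.det.sign • F.1.comp ⟨IrrVec.transposeMul γ, IrrVec.transposeMul_continuous γ⟩, by
    intro α hα ω
    simp only [ContinuousMap.smul_apply, ContinuousMap.comp_apply, ContinuousMap.coe_mk,
      IrrVec.transposeMul_scale]
    rw [F.2 α hα]⟩
  map_zero' := by
    apply Subtype.ext; ext ω; simp
  map_add' F F' := by
    apply Subtype.ext; ext ω; simp

lemma star_apply (γ : IntMat) (F : A0) (ω : IrrVec) :
    (starAct γ F).1 ω = γ.1.det.sign • F.1 (IrrVec.transposeMul γ ω) := rfl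

lemma star_mul (γ δ : IntMat) (F : A0) : starAct (γ * δ) F = starAct γ (starAct δ F) := by
  apply Subtype.ext
  ext ω
  simp only [star_apply, IrrVec.transposeMul_mul, Submonoid.coe_mul, Matrix.det_mul, Int.sign_mul,
    mul_smul]

/-- The action `(γ · ν)(x) = γ ⋆ ∑_{y γᵀ = x} ν(y)` of `𝓜` on maps `ν : ℚ²/ℤ² → 𝒜₀`. -/
def matAct (γ : IntMat) : (QZ2 → A0) →+ (QZ2 → A0) where
  toFun ν x := starAct γ (∑ᶠ y ∈ {y : QZ2 | rowMul γ.1 y = x}, ν y)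
  map_zero' := by
    funext x
    simp
  map_add' ν ν' := by
    funext x
    simp only [Pi.add_apply, ← map_add]
    rw [finsum_mem_add_distrib (finite_fiber γ x)]

lemma matAct_apply (γ : IntMat) (ν : QZ2 → A0) (x : QZ2) :
    matAct γ ν x = starAct γ (∑ y ∈ (finite_fiber γ x).toFinset, ν y) := by
  change starAct γ (∑ᶠ y ∈ {y : QZ2 | rowMul γ.1 y = x}, ν y) = _
  rw [finsum_mem_eq_finite_toFinset_sum _ (finite_fiber γ x)]

lemma matAct_mul (γ δ : IntMat) (ν : QZ2 → A0) :
    matAct (γ * δ) ν = matAct γ (matAct δ ν) := by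
  classical
  funext x
  simp only [matAct_apply, star_mul]
  rw [← map_sum (starAct δ)]
  congr 2
  rw [← Finset.sum_fiberwise_of_maps_to (s := (finite_fiber (γ * δ) x).toFinset)
    (t := (finite_fiber γ x).toFinset) (g := fun y => rowMul δ.1 y)]
  · refine Finset.sum_congr rfl fun y hy => ?_
    refine Finset.sum_congr ?_ fun _ _ => rfl
    ext z
    simp only [Set.Finite.mem_toFinset, Set.mem_ofPred_eq, Finset.mem_filter, Submonoid.coe_mul,
      rowMul_mul] at *
    constructor
    · exact fun h => h.2
    · intro h
      exact ⟨by rw [h, hy], h⟩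
  · intro z hz
    simpa only [Set.Finite.mem_toFinset, Set.mem_ofPred_eq, Submonoid.coe_mul, rowMul_mul] using hz

/-- The scalar matrix `c I₂` as an element of `𝓜`. -/
def scalarMat (c : ℤ) (hc : c ≠ 0) : IntMat := ⟨!![c, 0; 0, c], by simp [IntMat, hc]⟩

lemma finite_smul_eq {c : ℕ} (hc : 0 < c) (x : QZ2) : {y : QZ2 | c • y = x}.Finite := by
  refine (finite_fiber (scalarMat c (by exact_mod_cast hc.ne')) x).subset ?_
  intro y hy
  simpa only [Set.mem_ofPred_eq, scalarMat, rowMul_scalar, natCast_zsmul] using hy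

/-- The group `D₀` of `𝒜₀`-valued homogeneous distributions on `ℚ²/ℤ²`. -/
def D0 : AddSubgroup (QZ2 → A0) where
  carrier := {ν | ∀ c : ℕ, 0 < c → ∀ x : QZ2, ν x = ∑ᶠ y ∈ {y : QZ2 | c • y = x}, ν y}
  zero_mem' := by
    intro c hc x
    simp
  add_mem' := by
    intro ν ν' h h' c hc x
    have hf := finite_smul_eq hc x
    simp only [Pi.add_apply]
    rw [finsum_mem_add_distrib hf, ← h c hc x, ← h' c hc x]
  neg_mem' := by
    intro ν h c hc x
    have hf := finite_smul_eq hc x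
    simp only [Pi.neg_apply]
    rw [finsum_mem_eq_finite_toFinset_sum _ hf, Finset.sum_neg_distrib,
      ← finsum_mem_eq_finite_toFinset_sum _ hf, ← h c hc x]

lemma scalarMat_mul_comm (c : ℤ) (hc : c ≠ 0) (γ : IntMat) :
    scalarMat c hc * γ = γ * scalarMat c hc := by
  apply Subtype.ext
  change !![c, 0; 0, c] * γ.1 = γ.1 * !![c, 0; 0, c]
  rw [← smul_one_eq, smul_mul_assoc, one_mul, mul_smul_comm, mul_one]

lemma star_scalarMat {c : ℕ} (hc : 0 < c) (F : A0) :
    starAct (scalarMat c (by exact_mod_cast hc.ne')) F = F := by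
  apply Subtype.ext
  ext ω
  have hc' : (0 : ℝ) < c := by exact_mod_cast hc
  rw [star_apply, ← F.2 (c : ℝ) hc' ω]
  have h1 : (scalarMat (c : ℤ) (by exact_mod_cast hc.ne')).1.det.sign = 1 := by
    rw [Int.sign_eq_one_iff_pos]
    simp [scalarMat, hc]
  have h2 : IrrVec.transposeMul (scalarMat (c : ℤ) (by exact_mod_cast hc.ne')) ω
      = IrrVec.scale hc'.ne' ω := by
    apply Subtype.ext
    funext i
    fin_cases i <;>
      simp [IrrVec.transposeMul, IrrVec.scale, scalarMat]
  rw [h1, h2, one_smul]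

lemma mem_D0_iff (ν : QZ2 → A0) :
    ν ∈ D0 ↔ ∀ (c : ℕ) (hc : 0 < c), matAct (scalarMat c (by exact_mod_cast hc.ne')) ν = ν := by
  have key : ∀ (c : ℕ) (hc : 0 < c) (x : QZ2),
      matAct (scalarMat c (by exact_mod_cast hc.ne')) ν x
        = ∑ᶠ y ∈ {y : QZ2 | c • y = x}, ν y := by
    intro c hc x
    change starAct _ (∑ᶠ y ∈ {y : QZ2 | rowMul _ y = x}, ν y) = _
    rw [star_scalarMat hc]
    simp only [scalarMat, rowMul_scalar, natCast_zsmul]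
  constructor
  · intro h c hc
    funext x
    rw [key c hc x, ← h c hc x]
  · intro h c hc x
    rw [← key c hc x, h c hc]

lemma matAct_mem_D0 (γ : IntMat) {ν : QZ2 → A0} (hν : ν ∈ D0) : matAct γ ν ∈ D0 := by
  rw [mem_D0_iff] at hν ⊢
  intro c hc
  rw [← matAct_mul, scalarMat_mul_comm, matAct_mul, hν c hc]

/-- The action of `𝓜` on `D₀`. -/
def distAct (γ : IntMat) : D0 →+ D0 where
  toFun ν := ⟨matAct γ ν.1, matAct_mem_D0 γ ν.2⟩
  map_zero' := by apply Subtype.ext; exact map_zero (matAct γ)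
  map_add' ν ν' := by apply Subtype.ext; exact map_add (matAct γ) ν.1 ν'.1

lemma distAct_mul (γ δ : IntMat) (ν : D0) : distAct (γ * δ) ν = distAct γ (distAct δ ν) :=
  Subtype.ext (matAct_mul γ δ ν.1)

lemma distAct_congr {γ δ : IntMat} {c d : ℕ} (hc : 0 < c) (hd : 0 < d)
    (h : (c : ℤ) • γ.1 = (d : ℤ) • δ.1) (ν : D0) : distAct γ ν = distAct δ ν := by
  have aux : ∀ (e : ℕ) (he : 0 < e) (η : IntMat),
      distAct (scalarMat e (by exact_mod_cast he.ne') * η) ν = distAct η ν := by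
    intro e he η
    rw [distAct_mul]
    exact Subtype.ext ((mem_D0_iff _).mp (distAct η ν).2 e he)
  rw [← aux c hc γ, ← aux d hd δ]
  congr 2
  apply Subtype.ext
  change !![(c : ℤ), 0; 0, c] * γ.1 = !![(d : ℤ), 0; 0, d] * δ.1
  rw [← smul_one_eq, ← smul_one_eq, smul_mul_assoc, one_mul, smul_mul_assoc, one_mul, h]

lemma exists_clear (g : GL (Fin 2) ℚ) :
    ∃ p : ℕ × IntMat, 0 < p.1 ∧ p.2.1.map (Int.cast : ℤ → ℚ) = (p.1 : ℚ) • g.1 := by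
  obtain ⟨b, hb⟩ := IsLocalization.exist_integer_multiples_of_finset (nonZeroDivisors ℤ)
    (Finset.univ.image fun ij : Fin 2 × Fin 2 => g.1 ij.1 ij.2)
  have hb0 : b.1 ≠ 0 := nonZeroDivisors.ne_zero b.2
  have hb1 : ∀ i j, ∃ m : ℤ, (m : ℚ) = (b.1.natAbs : ℚ) * g.1 i j := by
    intro i j
    obtain ⟨m, hm⟩ := hb (g.1 i j) (Finset.mem_image.mpr ⟨(i, j), Finset.mem_univ _, rfl⟩)
    have hm' : (m : ℚ) = (b.1 : ℚ) * g.1 i j := by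
      simpa [Algebra.smul_def] using hm
    refine ⟨b.1.sign * m, ?_⟩
    push_cast
    rw [hm', ← mul_assoc, Nat.cast_natAbs, ← Int.cast_mul, Int.sign_mul_self_eq_abs]
  choose m hm using hb1
  have hmap : (Matrix.of m).map (Int.cast : ℤ → ℚ) = (b.1.natAbs : ℚ) • g.1 := by
    ext i j
    simp only [Matrix.map_apply, Matrix.of_apply, Matrix.smul_apply, smul_eq_mul, hm]
  have hdet : (Matrix.of m).det ≠ 0 := by
    intro h0
    have h1 : ((Matrix.of m).map (Int.cast : ℤ → ℚ)).det = 0 := by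
      rw [show (Int.cast : ℤ → ℚ) = Int.castRingHom ℚ from rfl, ← RingHom.mapMatrix_apply,
        ← RingHom.map_det, h0, map_zero]
    rw [hmap, Matrix.det_smul] at h1
    rcases mul_eq_zero.mp h1 with h2 | h2
    · simp at h2
    · exact (Matrix.isUnits_det_units g).ne_zero h2
  exact ⟨(b.1.natAbs, ⟨Matrix.of m, hdet⟩), Int.natAbs_pos.mpr hb0, hmap⟩

/-- Some pair `(c, c γ)` with a positive integer `c` such that `c γ ∈ 𝓜`. -/
def clearDenom (g : GL (Fin 2) ℚ) : ℕ × IntMat := Classical.choose (exists_clear g)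

/-- The action of `GL₂(ℚ)` on `D₀`: `γ · ν = (c γ) · ν`. -/
def glAct (g : GL (Fin 2) ℚ) : D0 →+ D0 := distAct (clearDenom g).2

/-- The action of `GL₂(ℚ)` does not depend on the choice of `c`. -/
lemma glAct_eq (g : GL (Fin 2) ℚ) (c : ℕ) (γ : IntMat) (hc : 0 < c)
    (h : γ.1.map (Int.cast : ℤ → ℚ) = (c : ℚ) • g.1) (ν : D0) : glAct g ν = distAct γ ν := by
  obtain ⟨h1, h2⟩ := Classical.choose_spec (exists_clear g)
  refine distAct_congr hc h1 ?_ ν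
  ext i j
  have e1 := congrFun (congrFun h i) j
  have e2 := congrFun (congrFun h2 i) j
  simp only [Matrix.map_apply, Matrix.smul_apply, smul_eq_mul] at e1 e2 ⊢
  have : ((c : ℤ) * (clearDenom g).2.1 i j : ℚ) = ((clearDenom g).1 : ℤ) * γ.1 i j := by
    change (c : ℚ) * _ = _
    rw [e1, show (((clearDenom g).2.1 i j : ℤ) : ℚ) = _ from e2]
    simp only [clearDenom, Int.cast_natCast]
    ring
  exact_mod_cast this

lemma glAct_one (ν : D0) : glAct 1 ν = ν := by
  rw [glAct_eq 1 1 (scalarMat 1 one_ne_zero) one_pos (by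
    ext i j; fin_cases i <;> fin_cases j <;> simp [scalarMat])]
  exact Subtype.ext ((mem_D0_iff _).mp ν.2 1 one_pos)

lemma glAct_mul (g h : GL (Fin 2) ℚ) (ν : D0) : glAct (g * h) ν = glAct g (glAct h ν) := by
  obtain ⟨g1, g2⟩ := Classical.choose_spec (exists_clear g)
  obtain ⟨h1, h2⟩ := Classical.choose_spec (exists_clear h)
  rw [glAct_eq (g * h) ((clearDenom g).1 * (clearDenom h).1) ((clearDenom g).2 * (clearDenom h).2)
    (Nat.mul_pos g1 h1)]
  · exact distAct_mul _ _ ν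
  · have e : (((clearDenom g).2 * (clearDenom h).2 : IntMat).1).map (Int.cast : ℤ → ℚ)
        = (clearDenom g).2.1.map (Int.cast : ℤ → ℚ) * (clearDenom h).2.1.map (Int.cast : ℤ → ℚ) :=
      map_mul (Int.castRingHom ℚ).mapMatrix _ _
    rw [e, show (clearDenom g).2.1.map (Int.cast : ℤ → ℚ) = _ from g2,
      show (clearDenom h).2.1.map (Int.cast : ℤ → ℚ) = _ from h2, Units.val_mul, Matrix.smul_mul,
      Matrix.mul_smul, smul_smul, Nat.cast_mul]
    rfl

/-- The group `𝒟₀` of elements of `D₀` fixed by `-I₂`. -/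
def calD0 : AddSubgroup D0 where
  carrier := {ν | glAct (-1) ν = ν}
  zero_mem' := map_zero (glAct (-1))
  add_mem' := by
    intro ν ν' h h'
    simp only [Set.mem_ofPred_eq] at *
    rw [map_add, h, h']
  neg_mem' := by
    intro ν h
    simp only [Set.mem_ofPred_eq] at *
    rw [map_neg, h]

/-- The representation of `GL₂(ℚ)` on `𝒟₀`. -/
def glRep : GL (Fin 2) ℚ →* Module.End ℤ calD0 where
  toFun g := AddMonoidHom.toIntLinearMap
    { toFun := fun ν => ⟨glAct g ν.1, by
        change glAct (-1) (glAct g ν.1) = glAct g ν.1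
        rw [← glAct_mul, neg_one_mul, ← mul_neg_one, glAct_mul]
        rw [show glAct (-1) ν.1 = ν.1 from ν.2]⟩
      map_zero' := by apply Subtype.ext; exact map_zero (glAct g)
      map_add' := fun ν ν' => by apply Subtype.ext; exact map_add (glAct g) ν.1 ν'.1 }
  map_one' := by
    ext1 ν
    exact Subtype.ext (glAct_one ν.1)
  map_mul' g h := by
    ext1 ν
    exact Subtype.ext (glAct_mul g h ν.1)

lemma glAct_scalar_pos (u : ℚˣ) (hu : 0 < u.1) (ν : D0) :
    glAct (Matrix.GeneralLinearGroup.scalar (Fin 2) u) ν = ν := by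
  have hn : 0 < u.1.num := Rat.num_pos.mpr hu
  have hnat : ((u.1.num.natAbs : ℕ) : ℤ) = u.1.num := Int.natAbs_of_nonneg hn.le
  rw [glAct_eq _ u.1.den
    (scalarMat (u.1.num.natAbs : ℤ) (by rw [hnat]; exact hn.ne')) u.1.den_pos]
  · exact Subtype.ext ((mem_D0_iff _).mp ν.2 _ (Int.natAbs_pos.mpr hn.ne'))
  · have hq : ((u.1.num : ℤ) : ℚ) = (u.1.den : ℚ) * u.1 := by
      rw [mul_comm]; exact (Rat.mul_den_eq_num u.1).symm
    have hq' : ((u.1.num.natAbs : ℕ) : ℚ) = (u.1.den : ℚ) * u.1 := by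
      rw [← hq, ← Int.cast_natCast, hnat]
    ext i j
    generalize u.1.num.natAbs = n at *
    fin_cases i <;> fin_cases j <;> simp [scalarMat, hq', -Rat.den_mul_eq_num]

/-- The representation of `G = PGL₂(ℚ)` on `𝒟₀` induced by that of `GL₂(ℚ)`. -/
def pglRep : Representation ℤ (Matrix.ProjGenLinGroup (Fin 2) ℚ) calD0 :=
  Matrix.ProjGenLinGroup.lift glRep (by
    ext1 u
    apply LinearMap.ext
    intro ν
    apply Subtype.ext
    change glAct (Matrix.GeneralLinearGroup.scalar (Fin 2) u) ν.1 = ν.1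
    rcases lt_or_gt_of_ne u.ne_zero with hu | hu
    · have e : Matrix.GeneralLinearGroup.scalar (Fin 2) u
          = Matrix.GeneralLinearGroup.scalar (Fin 2) (-u) * (-1) := by
        ext i j
        fin_cases i <;> fin_cases j <;> simp
      rw [e, glAct_mul, show glAct (-1) ν.1 = ν.1 from ν.2]
      exact glAct_scalar_pos (-u) (by simpa using hu) ν.1
    · exact glAct_scalar_pos u hu ν.1)

/-- The `G`-module `𝒟₀`. -/
abbrev moduleD0 : Rep.{0} ℤ (Matrix.ProjGenLinGroup (Fin 2) ℚ) := Rep.of pglRep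

lemma det_map_ne_zero (γ : IntMat) : (γ.1.map (Int.cast : ℤ → ℚ)).det ≠ 0 := by
  rw [show (Int.cast : ℤ → ℚ) = Int.castRingHom ℚ from rfl, ← RingHom.mapMatrix_apply,
    ← RingHom.map_det]
  simpa using IntMat.det_ne_zero γ

/-- The class in `G = PGL₂(ℚ)` of a matrix in `𝓜`. -/
def toPGL (γ : IntMat) : Matrix.ProjGenLinGroup (Fin 2) ℚ :=
  Matrix.ProjGenLinGroup.mk
    (Matrix.GeneralLinearGroup.mkOfDetNeZero (γ.1.map (Int.cast : ℤ → ℚ)) (det_map_ne_zero γ))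

/-- The value `ν(x, ω)` of `ν ∈ 𝒟₀` at `x ∈ ℚ²` and `ω`. -/
def valueAt (ν : calD0) (x : Fin 2 → ℚ) (ω : IrrVec) : ℝ := (ν.1.1 (toQZ2 x)).1 ω

/-- The set `ℤ` inside `ℝ`. -/
def intSet : Set ℝ := Set.range (Int.cast : ℤ → ℝ)

/-- The indicator function of `ℤ`. -/
def indZ (y : ℝ) : ℝ := intSet.indicator 1 y

/-- The second periodic Bernoulli function. -/
def bernBar2 (y : ℝ) : ℝ := Int.fract y ^ 2 - Int.fract y + 1 / 6

open Classical in
/-- The first periodic Bernoulli function, with value `0` at the integers. -/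
def bernBar1 (y : ℝ) : ℝ := if y ∈ intSet then 0 else Int.fract y - 1 / 2

/-- The Dedekind--Rademacher sum `S(a, c; x)` (for `c ≠ 0`); the summation over `ℤ/cℤ` runs over
the representatives `0, …, |c| - 1`. -/
def dedekindRademacher (a c : ℤ) (x : Fin 2 → ℝ) : ℝ :=
  ∑ m ∈ Finset.range c.natAbs,
    bernBar1 (x 0 + (x 1 + m) * ((a : ℝ) / c)) * bernBar1 ((x 1 + m) * (1 / (c : ℝ)))

/-- The explicit function `𝔷₀(γ)(x, ω)`. -/
def zExplicit (γ : IntMat) (x : Fin 2 → ℚ) (ω : IrrVec) : ℝ :=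
  let a : ℤ := γ.1 0 0
  let c : ℤ := γ.1 1 0
  let g : ℝ := (Int.gcd a c : ℝ)
  let τ : ℝ := ω.1 1 / ω.1 0
  let x' : Fin 2 → ℝ := fun i => (x i : ℝ)
  if c = 0 then 0 else
    g ^ 2 / (2 * c * (a + c * τ)) * bernBar2 (c / g * x' 0 - a / g * x' 1)
      + (a + c * τ) / (2 * c) * bernBar2 (x' 1)
      + Real.sign c * dedekindRademacher (-a) c x'
      - Real.sign (c * (a + c * τ)) / 4 * indZ (x' 0) * indZ (x' 1)

/-- `f` is a meromorphic continuation to `ℂ` of the Barnes double Dirichlet series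
`∑_{m, n ≥ 0} (z + m ω₁ + n ω₂)^(-s)`, which is to converge absolutely for `Re s > 2`. The normal
form makes the value of `f` at each of its regular points the correct one. -/
def IsBarnesZeta2 (z : ℝ) (ω : Fin 2 → ℝ) (f : ℂ → ℂ) : Prop :=
  MeromorphicNFOn f Set.univ ∧
    ∀ s : ℂ, 2 < s.re →
      HasSum (fun p : ℕ × ℕ => ((z + p.1 * ω 0 + p.2 * ω 1 : ℝ) : ℂ) ^ (-s)) (f s)

/-- The Barnes double zeta function `s ↦ ζ₂(z, ω, s)`. -/
def barnesZeta2 (z : ℝ) (ω : Fin 2 → ℝ) : ℂ → ℂ := Classical.epsilon (IsBarnesZeta2 z ω)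

/-- The representative `⟨y⟩ ∈ (0, 1]` of `y` modulo `ℤ`. -/
def upperFract (y : ℝ) : ℝ := toIocMod (zero_lt_one : (0 : ℝ) < 1) 0 y

/-- The matrix with rows `(0, -1)` and `(1, 0)`. -/
def matS : IntMat := ⟨!![0, -1; 1, 0], by simp [IntMat]⟩

/-- The matrix with rows `(1, a)` and `(0, c)`. -/
def matUpper (a c : ℤ) (hc : c ≠ 0) : IntMat := ⟨!![1, a; 0, c], by simp [IntMat, hc]⟩

end RademacherCocycle

end

open RademacherCocycle

/-! The group `G` acts on the projective line over `ℚ`, and the value of the cocycle at `γ` depends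
only on the point `γ∞ = (a : c)`, the first column of `γ`. All values come from one distribution,
`core`, the value at `S = (0, -1; 1, 0)`: the sum of `B̄₂(x₁)/(2τ)`, `τ B̄₂(x₂)/2` and `B̄₁(x₁)
B̄₁(x₂)`, minus a sign term at the integral points.

Letting an upper triangular matrix with second column `(a, c)` act on `core` means summing over
fibres. The distribution relations of `B̄₁`, `B̄₂` and the indicator of `ℤ` evaluate these sums to
the explicit formula, and the top left entry drops out (`matAct_upper_value`). Hence diagonal
matrices fix `core`; scalar matrices among them show that `core` lies in `𝒟₀`. Assigning `(1, a; 0,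
c) · core` to `(a : c)`, and `0` to `∞`, is therefore well defined on `G`.

The cocycle law is equivalent to `columnCocycle_second_column`: for `M` with columns `(a, c)` and
`(b, d)`, the values at the two columns differ by `M · core`. Up to upper triangular factors on the
left and diagonal ones on the right, this is either `S · core = -core` or `T⁻¹ · core = ST · core +
core`. The latter is the classical three-term relation of Bernoulli functions
(`bernBar_three_term`), whose defect at integral points is absorbed by the sign term.

For (i), the Mellin transform of `∑ exp(-pᵢ t)` shows that the value of `∑ pᵢ^(-s)` at `s = 0` is
the constant term of the expansion of the exponential sum at `t = 0`; for the Barnes and Hurwitz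
series this is a product of Todd series. For (iii), at a fixed point `a + cτ` is the eigenvalue `α`,
both `B̄₂` terms have the same Bernoulli factor, and `α + α⁻¹ = a + d`. The class is nonzero because
a coboundary vanishes at `x = 0` and an `ω` with positive eigenvalue, whereas this formula gives
`1/12` for one hyperbolic matrix. -/

namespace RademacherCocycle

/-! ### Second-order Taylor expansions of the exponential and Todd functions. -/

section Jets

open Filter Topology

/-- Taylor expansion of an analytic function at `0`, with analytic remainder. -/
lemma exists_taylor {f : ℂ → ℂ} {p : FormalMultilinearSeries ℂ ℂ ℂ} (hp : HasFPowerSeriesAt f p 0)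
    (n : ℕ) : ∃ r : ℂ → ℂ, AnalyticAt ℂ r 0 ∧
      ∀ u, f u = ∑ k ∈ Finset.range n, p.coeff k * u ^ k + u ^ n * r u := by
  -- The remainder is the `n`-fold divided difference at `0`; its value at `0` is the next Taylor
  -- coefficient.
  refine ⟨(Function.swap dslope 0)^[n] f,
    (hp.has_fpower_series_iterate_dslope_fslope n).analyticAt, ?_⟩
  induction n with
  | zero => intro u; simp
  | succ n ih =>
    intro u
    have h0 : (Function.swap dslope 0)^[n] f 0 = p.coeff n := by
      rw [← (hp.has_fpower_series_iterate_dslope_fslope n).coeff_zero 1,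
        ← FormalMultilinearSeries.coeff, FormalMultilinearSeries.coeff_iterate_fslope, zero_add]
    have h1 := sub_smul_dslope ((Function.swap dslope 0)^[n] f) 0 u
    rw [h0, sub_zero, smul_eq_mul] at h1
    rw [ih u, Finset.sum_range_succ, Function.iterate_succ_apply', Function.swap, pow_succ]
    linear_combination (-u ^ n) * h1

/-- `g` is analytic at `0` with Taylor polynomial `a₀ + a₁ u + a₂ u²` of order two. -/
def HasJet (g : ℂ → ℂ) (a₀ a₁ a₂ : ℂ) : Prop :=
  ∃ r : ℂ → ℂ, AnalyticAt ℂ r 0 ∧ ∀ᶠ u in 𝓝 0, g u = a₀ + a₁ * u + a₂ * u ^ 2 + u ^ 3 * r u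

lemma HasJet.mul {g h : ℂ → ℂ} {a₀ a₁ a₂ b₀ b₁ b₂ : ℂ} (hg : HasJet g a₀ a₁ a₂)
    (hh : HasJet h b₀ b₁ b₂) :
    HasJet (fun u => g u * h u) (a₀ * b₀) (a₀ * b₁ + a₁ * b₀) (a₀ * b₂ + a₁ * b₁ + a₂ * b₀) := by
  obtain ⟨r, hr, hg⟩ := hg
  obtain ⟨q, hq, hh⟩ := hh
  refine ⟨fun u => a₁ * b₂ + a₂ * b₁ + a₂ * b₂ * u + r u * (b₀ + b₁ * u + b₂ * u ^ 2 + u ^ 3 * q u)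
    + (a₀ + a₁ * u + a₂ * u ^ 2) * q u, by fun_prop, ?_⟩
  filter_upwards [hg, hh] with u h1 h2
  rw [h1, h2]
  ring

lemma HasJet.comp_mul {g : ℂ → ℂ} {a₀ a₁ a₂ : ℂ} (hg : HasJet g a₀ a₁ a₂) (c : ℂ) :
    HasJet (fun u => g (c * u)) a₀ (a₁ * c) (a₂ * c ^ 2) := by
  obtain ⟨r, hr, hg⟩ := hg
  have ht : Tendsto (fun u : ℂ => c * u) (𝓝 0) (𝓝 0) :=
    Continuous.tendsto' (by fun_prop) _ _ (by simp)
  refine ⟨fun u => c ^ 3 * r (c * u), ?_, ?_⟩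
  · exact analyticAt_const.mul (AnalyticAt.fun_comp (by simpa using hr) (by fun_prop))
  · filter_upwards [ht.eventually hg] with u h
    rw [h]
    ring

lemma HasJet.const_mul {g : ℂ → ℂ} {a₀ a₁ a₂ : ℂ} (hg : HasJet g a₀ a₁ a₂) (c : ℂ) :
    HasJet (fun u => c * g u) (c * a₀) (c * a₁) (c * a₂) := by
  obtain ⟨r, hr, hg⟩ := hg
  refine ⟨fun u => c * r u, by fun_prop, ?_⟩
  filter_upwards [hg] with u h
  rw [h]
  ring

/-- One order more than a jet carries, because `toddFun` divides by `1 - exp (-u)`, which vanishes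
to first order. -/
lemma exp_expansion : ∃ r : ℂ → ℂ, AnalyticAt ℂ r 0 ∧
    ∀ u, Complex.exp u = 1 + u + u ^ 2 / 2 + u ^ 3 / 6 + u ^ 4 * r u := by
  have hp : HasFPowerSeriesAt Complex.exp (NormedSpace.expSeries ℂ ℂ) 0 := by
    rw [Complex.exp_eq_exp_ℂ]
    exact NormedSpace.exp_hasFPowerSeriesAt_zero
  obtain ⟨r, hr, h⟩ := exists_taylor hp 4
  refine ⟨r, hr, fun u => ?_⟩
  have hc : ∀ k, (NormedSpace.expSeries ℂ ℂ).coeff k = ((k.factorial : ℂ))⁻¹ := by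
    intro k
    have h1 : (List.ofFn (1 : Fin k → ℂ)).prod = 1 := by
      change (List.ofFn (fun _ : Fin k => (1 : ℂ))).prod = 1
      simp
    simp [FormalMultilinearSeries.coeff, NormedSpace.expSeries, h1]
  rw [h u]
  simp only [hc, Finset.sum_range_succ, Finset.sum_range_zero, Nat.factorial]
  push_cast
  ring

lemma hasJet_exp (c : ℂ) : HasJet (fun u => Complex.exp (c * u)) 1 c (c ^ 2 / 2) := by
  obtain ⟨r, hr, h⟩ := exp_expansion
  have : HasJet Complex.exp 1 1 (1 / 2) :=
    ⟨fun u => 1 / 6 + u * r u, by fun_prop, Eventually.of_forall fun u => by rw [h]; ring⟩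
  convert this.comp_mul c using 1 <;> ring

/-- The function `u / (1 - e^{-u})`, with its value at `0` filled in. -/
noncomputable def toddFun (u : ℂ) : ℂ := if u = 0 then 1 else u / (1 - Complex.exp (-u))

lemma hasJet_toddFun : HasJet toddFun 1 (1 / 2) (1 / 12) := by
  obtain ⟨r, hr, h⟩ : ∃ r : ℂ → ℂ, AnalyticAt ℂ r 0 ∧
      ∀ u, Complex.exp (-u) = 1 - u + u ^ 2 / 2 - u ^ 3 / 6 + u ^ 4 * r u := by
    obtain ⟨r, hr, h⟩ := exp_expansion
    exact ⟨fun u => r (-u), AnalyticAt.fun_comp (by simpa using hr) (by fun_prop),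
      fun u => by rw [h]; ring⟩
  -- `e u` is `(1 - exp (-u)) / u` with the singularity removed, so `toddFun = 1 / e` near `0`. The
  -- remainder is `(1 - e u (1 + u/2 + u²/12)) / (u³ e u)`, its numerator divided out by `u³`.
  set e : ℂ → ℂ := fun u => 1 - u / 2 + u ^ 2 / 6 - u ^ 3 * r u with he
  have hea : AnalyticAt ℂ e 0 := by rw [he]; fun_prop
  have he0 : e 0 ≠ 0 := by simp [he]
  refine ⟨fun u => (-(1 / 24 + u / 72) + r u * (1 + 1 / 2 * u + 1 / 12 * u ^ 2)) / e u,
    ?_, ?_⟩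
  · exact AnalyticAt.div (by fun_prop) hea he0
  · filter_upwards [hea.continuousAt.eventually_ne he0] with u hu
    have h1 : 1 - Complex.exp (-u) = u * e u := by rw [h, he]; ring
    rcases eq_or_ne u 0 with rfl | hu0
    · simp [toddFun]
    · have : toddFun u = 1 / e u := by
        rw [toddFun, if_neg hu0, h1]
        field_simp
      rw [this]
      field_simp
      simp only [he]
      ring

/-- Full asymptotic expansion extending a given jet. -/
lemma HasJet.exists_coeff {g : ℂ → ℂ} {a₀ a₁ a₂ : ℂ} (hg : HasJet g a₀ a₁ a₂) :
    ∃ c : ℕ → ℂ, c 0 = a₀ ∧ c 1 = a₁ ∧ c 2 = a₂ ∧ ∀ N, 3 ≤ N → ∃ r : ℂ → ℂ, ContinuousAt r 0 ∧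
      ∀ᶠ u in 𝓝 0, g u = ∑ k ∈ Finset.range N, c k * u ^ k + u ^ N * r u := by
  obtain ⟨r, ⟨p, hp⟩, hg⟩ := hg
  refine ⟨fun k => match k with | 0 => a₀ | 1 => a₁ | 2 => a₂ | k + 3 => p.coeff k,
    rfl, rfl, rfl, fun N hN => ?_⟩
  obtain ⟨j, rfl⟩ := Nat.exists_eq_add_of_le' hN
  obtain ⟨q, hq, h⟩ := exists_taylor hp j
  refine ⟨q, hq.continuousAt, ?_⟩
  filter_upwards [hg] with u hu
  rw [hu, h u, Finset.sum_range_succ', Finset.sum_range_succ', Finset.sum_range_succ']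
  simp only [mul_add, Finset.mul_sum, pow_succ]
  rw [Finset.sum_congr rfl (fun k _ => by ring :
    ∀ k ∈ Finset.range j, u ^ 0 * u * u * u * (p.coeff k * u ^ k) = p.coeff k * (u ^ k * u * u * u))]
  ring

end Jets

/-! ### Mellin continuation of Dirichlet series. -/

section Continuation

open Filter Topology Set Asymptotics MeasureTheory

/-- The function `F` minus the first `N` terms of the expansion `∑ c_k t^(k-d)`, the latter cut off
outside `(0, 1]`. -/
noncomputable def cutRemainder (c : ℕ → ℂ) (d : ℕ) (F : ℝ → ℂ) (N : ℕ) (t : ℝ) : ℂ :=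
  F t - ∑ k ∈ Finset.range N, c k • (Ioc (0 : ℝ) 1).indicator (fun t => (t : ℂ) ^ ((k : ℂ) - d)) t

/-- The Mellin transform of `F`, continued by means of the first `N` terms of its expansion. -/
noncomputable def mellinCont (c : ℕ → ℂ) (d : ℕ) (F : ℝ → ℂ) (N : ℕ) (s : ℂ) : ℂ :=
  ∑ k ∈ Finset.range N, c k / (s + k - d) + mellin (cutRemainder c d F N) s

/-- `F` has the asymptotic expansion `∑ c_k t^(k-d)` at `0`, decays exponentially at `∞` and is
continuous. -/
structure HasExpansion (c : ℕ → ℂ) (d : ℕ) (F : ℝ → ℂ) : Prop where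
  continuousOn : ContinuousOn F (Ioi 0)
  decay : ∃ a : ℝ, 0 < a ∧ F =O[atTop] fun t => Real.exp (-a * t)
  expansion : ∀ N, 3 ≤ N → ∃ r : ℂ → ℂ, ContinuousAt r 0 ∧ ∀ᶠ t : ℝ in 𝓝[>] 0,
    F t = (∑ k ∈ Finset.range N, c k * (t : ℂ) ^ k + (t : ℂ) ^ N * r t) / (t : ℂ) ^ d

variable {c : ℕ → ℂ} {d : ℕ} {F : ℝ → ℂ}

lemma HasExpansion.locallyIntegrableOn (h : HasExpansion c d F) (N : ℕ) :
    LocallyIntegrableOn (cutRemainder c d F N) (Ioi 0) := by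
  refine (h.continuousOn.locallyIntegrableOn measurableSet_Ioi).sub ?_
  have : ∀ k ∈ Finset.range N, LocallyIntegrableOn (fun t : ℝ =>
      c k • (Ioc (0 : ℝ) 1).indicator (fun t => (t : ℂ) ^ ((k : ℂ) - d)) t) (Ioi 0) := by
    intro k _
    refine LocallyIntegrableOn.smul ?_ (c k)
    have hc : ContinuousOn (fun t : ℝ => (t : ℂ) ^ ((k : ℂ) - d)) (Ioi 0) := fun t ht =>
      (Complex.continuousAt_ofReal_cpow_const _ _ (Or.inr (ne_of_gt ht))).continuousWithinAt
    intro t ht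
    obtain ⟨u, hu, hi⟩ := hc.locallyIntegrableOn (μ := volume) measurableSet_Ioi t ht
    exact ⟨u, hu, hi.indicator measurableSet_Ioc⟩
  induction N with
  | zero => simpa using (continuousOn_const (c := (0 : ℂ))).locallyIntegrableOn measurableSet_Ioi
  | succ N ih =>
    simp only [Finset.sum_range_succ]
    exact (ih fun k hk => this k (Finset.mem_range.mpr
      ((Finset.mem_range.mp hk).trans (Nat.lt_succ_self N)))).add (this N (by simp))

/-- The subtracted powers are cut off beyond `1`, so the remainder coincides with `F` there. -/
lemma HasExpansion.remainder_decay (h : HasExpansion c d F) (N : ℕ) :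
    ∃ a : ℝ, 0 < a ∧ cutRemainder c d F N =O[atTop] fun t => Real.exp (-a * t) := by
  obtain ⟨a, ha, hF⟩ := h.decay
  refine ⟨a, ha, hF.congr' ?_ EventuallyEq.rfl⟩
  filter_upwards [eventually_gt_atTop 1] with t ht
  rw [cutRemainder, Finset.sum_eq_zero, sub_zero]
  intro k _
  rw [indicator_of_notMem (by simp [ht]), smul_zero]

/-- On `(0, 1]` the cut-off is invisible, and what is left of the expansion is `t^(N-d)` times a
function bounded near `0`. -/
lemma HasExpansion.remainder_isBigO (h : HasExpansion c d F) {N : ℕ} (hN : 3 ≤ N) :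
    cutRemainder c d F N =O[𝓝[>] 0] fun t : ℝ => t ^ (-((d : ℝ) - N)) := by
  obtain ⟨r, hr, he⟩ := h.expansion N hN
  have h1 : (fun t : ℝ => r (t : ℂ)) =O[𝓝[>] 0] fun _ => (1 : ℝ) := by
    refine Tendsto.isBigO_one ℝ (c := r 0) ?_
    have : Tendsto (fun t : ℝ => (t : ℂ)) (𝓝[>] 0) (𝓝 0) :=
      (Complex.continuous_ofReal.tendsto' 0 0 (by simp)).mono_left nhdsWithin_le_nhds
    exact hr.tendsto.comp this
  have h2 : (fun t : ℝ => ((t ^ (-((d : ℝ) - N)) : ℝ) : ℂ)) =O[𝓝[>] 0]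
      fun t : ℝ => t ^ (-((d : ℝ) - N)) := by
    refine IsBigO.of_bound 1 (Eventually.of_forall fun t => ?_)
    simp
  refine ((h2.mul h1).congr' ?_ ?_)
  · filter_upwards [he, Ioc_mem_nhdsGT (zero_lt_one : (0 : ℝ) < 1)] with t ht ht1
    have ht0 : (t : ℂ) ≠ 0 := by exact_mod_cast ht1.1.ne'
    have e1 : ∀ k ∈ Finset.range N, c k • (Ioc (0 : ℝ) 1).indicator
        (fun t => (t : ℂ) ^ ((k : ℂ) - d)) t = c k * (t : ℂ) ^ k / (t : ℂ) ^ d := by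
      intro k _
      rw [indicator_of_mem ht1, Complex.cpow_sub _ _ ht0, Complex.cpow_natCast,
        Complex.cpow_natCast, smul_eq_mul, mul_div_assoc]
    rw [cutRemainder, Finset.sum_congr rfl e1, ← Finset.sum_div, ht, neg_sub,
      Real.rpow_sub ht1.1, Real.rpow_natCast, Real.rpow_natCast]
    push_cast
    ring
  · exact Eventually.of_forall fun t => by simp

lemma HasExpansion.mellinConvergent (h : HasExpansion c d F) {N : ℕ} (hN : 3 ≤ N) {s : ℂ}
    (hs : (d : ℝ) - N < s.re) : MellinConvergent (cutRemainder c d F N) s := by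
  obtain ⟨a, ha, hd⟩ := h.remainder_decay N
  exact mellinConvergent_of_isBigO_rpow_exp ha (h.locallyIntegrableOn N) hd
    (h.remainder_isBigO hN) hs

lemma HasExpansion.differentiableAt (h : HasExpansion c d F) {N : ℕ} (hN : 3 ≤ N) {s : ℂ}
    (hs : (d : ℝ) - N < s.re) : DifferentiableAt ℂ (mellin (cutRemainder c d F N)) s := by
  obtain ⟨a, ha, hd⟩ := h.remainder_decay N
  exact mellin_differentiableAt_of_isBigO_rpow_exp ha (h.locallyIntegrableOn N) hd
    (h.remainder_isBigO hN) hs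

lemma HasExpansion.analyticAt (h : HasExpansion c d F) {N : ℕ} (hN : 3 ≤ N) {s : ℂ}
    (hs : (d : ℝ) - N < s.re) : AnalyticAt ℂ (mellin (cutRemainder c d F N)) s := by
  have ho : IsOpen {s : ℂ | (d : ℝ) - N < s.re} :=
    isOpen_lt continuous_const Complex.continuous_re
  exact DifferentiableOn.analyticAt
    (fun z hz => (h.differentiableAt hN hz).differentiableWithinAt) (ho.mem_nhds hs)

lemma hasMellin_cut (c : ℂ) (k d : ℕ) {s : ℂ} (hs : (d : ℝ) - k < s.re) :
    HasMellin (fun t : ℝ => c • (Ioc (0 : ℝ) 1).indicator (fun t => (t : ℂ) ^ ((k : ℂ) - d)) t) s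
      (c / (s + k - d)) := by
  have := hasMellin_cpow_Ioc ((k : ℂ) - d) (s := s) (by simp; linarith)
  have h2 := hasMellin_const_smul this.1 c
  rw [this.2, smul_eq_mul, mul_one_div, ← add_sub_assoc] at h2
  exact h2

/-- The new polar term is the Mellin transform of the power that leaves the remainder. The
continuations for different `N` thus glue to one function on the plane. -/
lemma HasExpansion.mellinCont_succ (h : HasExpansion c d F) {N : ℕ} (hN : 3 ≤ N) {s : ℂ}
    (hs : (d : ℝ) - N < s.re) : mellinCont c d F (N + 1) s = mellinCont c d F N s := by
  have h1 := hasMellin_cut (c N) N d hs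
  have h2 := hasMellin_sub (h.mellinConvergent hN hs) h1.1
  have h3 : cutRemainder c d F (N + 1) = fun t => cutRemainder c d F N t -
      c N • (Ioc (0 : ℝ) 1).indicator (fun t => (t : ℂ) ^ ((N : ℂ) - d)) t := by
    funext t
    rw [cutRemainder, cutRemainder, Finset.sum_range_succ, sub_sub]
  rw [mellinCont, mellinCont, h3, h2.2, h1.2, Finset.sum_range_succ]
  ring

lemma HasExpansion.mellinCont_eq (h : HasExpansion c d F) {N M : ℕ} (hN : 3 ≤ N) (hM : N ≤ M)
    {s : ℂ} (hs : (d : ℝ) - N < s.re) : mellinCont c d F M s = mellinCont c d F N s := by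
  induction M, hM using Nat.le_induction with
  | base => rfl
  | succ M hM ih =>
    rw [h.mellinCont_succ (hN.trans hM), ih]
    have : (N : ℝ) ≤ M := by exact_mod_cast hM
    linarith

lemma HasExpansion.mellin_eq (h : HasExpansion c d F) {N : ℕ} (hN : 3 ≤ N) {s : ℂ}
    (hs : (d : ℝ) < s.re) : mellin F s = mellinCont c d F N s := by
  have h1 : ∀ M : ℕ, HasMellin (fun t : ℝ => ∑ k ∈ Finset.range M,
      c k • (Ioc (0 : ℝ) 1).indicator (fun t => (t : ℂ) ^ ((k : ℂ) - d)) t) s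
      (∑ k ∈ Finset.range M, c k / (s + k - d)) := by
    intro M
    induction M with
    | zero => exact ⟨by simp [MellinConvergent], by simp [mellin]⟩
    | succ M ih =>
      simp only [Finset.sum_range_succ]
      have h2 := hasMellin_cut (c M) M d (s := s) (by
        have : (0 : ℝ) ≤ M := M.cast_nonneg
        linarith)
      have := hasMellin_add ih.1 h2.1
      rwa [ih.2, h2.2] at this
  have h2 : (d : ℝ) - N < s.re := by
    have : (0 : ℝ) ≤ N := N.cast_nonneg
    linarith
  have h3 := hasMellin_add (h1 N).1 (h.mellinConvergent hN h2)
  rw [(h1 N).2] at h3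
  rw [mellinCont, ← h3.2]
  congr 1
  funext t
  rw [cutRemainder]
  ring

/-- Meromorphic continuation of a Dirichlet series `∑ pᵢ^(-s)` and its value at `0`, from the
expansion at `0` of `∑ exp (-pᵢ t)`. -/
theorem HasExpansion.exists_continuation {ι : Type*} [Countable ι] {p : ι → ℝ}
    (h : HasExpansion c d F) (hp : ∀ i, 0 < p i)
    (hF : ∀ t ∈ Ioi (0 : ℝ), HasSum (fun i => ((Real.exp (-p i * t) : ℝ) : ℂ)) (F t))
    (hsum : ∀ σ : ℝ, d < σ → Summable fun i => 1 / p i ^ σ) :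
    ∃ f : ℂ → ℂ, MeromorphicNFOn f univ ∧
      (∀ s : ℂ, (d : ℝ) < s.re → HasSum (fun i => (p i : ℂ) ^ (-s)) (f s)) ∧
      AnalyticAt ℂ f 0 ∧ f 0 = c d := by
  have hΓ : ∀ s, AnalyticAt ℂ (fun s => (Complex.Gamma s)⁻¹) s := fun s =>
    Complex.differentiable_one_div_Gamma.analyticAt s
  -- Enough terms for the Mellin integral of the remainder to converge at `s`; the summand `3` meets
  -- the bound on `N` in `HasExpansion`.
  set M : ℂ → ℕ := fun s => ⌈(d : ℝ) - s.re⌉₊ + 3 with hM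
  have hMs : ∀ s, (d : ℝ) - M s < s.re := by
    intro s
    have := Nat.le_ceil ((d : ℝ) - s.re)
    simp only [hM]
    push_cast
    linarith
  have hM3 : ∀ s, 3 ≤ M s := fun s => by simp [hM]
  set f₀ : ℂ → ℂ := fun s => (Complex.Gamma s)⁻¹ * mellinCont c d F (M s) s with hf₀
  have hf₀N : ∀ N : ℕ, 3 ≤ N → ∀ s : ℂ, (d : ℝ) - N < s.re →
      f₀ s = (Complex.Gamma s)⁻¹ * mellinCont c d F N s := by
    intro N hN s hs
    rw [hf₀]
    dsimp only
    rw [← h.mellinCont_eq (hM3 s) (le_max_left (M s) N) (hMs s),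
      h.mellinCont_eq hN (le_max_right (M s) N) hs]
  have hopen : ∀ N : ℕ, ∀ s : ℂ, (d : ℝ) - N < s.re → ∀ᶠ z : ℂ in 𝓝 s, (d : ℝ) - N < z.re :=
    fun N s hs => (isOpen_lt continuous_const Complex.continuous_re).mem_nhds hs
  have hmer : MeromorphicOn f₀ univ := by
    intro s _
    have h1 : f₀ =ᶠ[𝓝 s] fun z => (Complex.Gamma z)⁻¹ * mellinCont c d F (M s) z := by
      filter_upwards [hopen (M s) s (hMs s)] with z hz
      exact hf₀N _ (hM3 s) z hz
    refine MeromorphicAt.congr ?_ (h1.symm.filter_mono nhdsWithin_le_nhds)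
    refine (hΓ s).meromorphicAt.mul ?_
    refine MeromorphicAt.add ?_ (h.analyticAt (hM3 s) (hMs s)).meromorphicAt
    refine MeromorphicAt.fun_sum fun k _ => ?_
    exact (MeromorphicAt.const _ _).fun_div (by fun_prop)
  -- At `s = d - k` the quotient by zero gives `f₀` a default value; the normal form restores the
  -- correct one wherever `1/Γ` cancels the pole.
  set f := toMeromorphicNFOn f₀ univ with hf
  have hfNF : MeromorphicNFOn f univ := meromorphicNFOn_toMeromorphicNFOn f₀ univ
  have hff₀ : ∀ s, f =ᶠ[𝓝[≠] s] f₀ := fun s =>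
    hmer.toMeromorphicNFOn_eq_self_on_nhdsNE (mem_univ s)
  have hloc : ∀ s (g : ℂ → ℂ), AnalyticAt ℂ g s → f₀ =ᶠ[𝓝[≠] s] g → f =ᶠ[𝓝 s] g := by
    intro s g hg hfg
    exact ((hfNF (mem_univ s)).eventuallyEq_nhdsNE_iff_eventuallyEq_nhds hg.meromorphicNFAt).mp
      ((hff₀ s).trans hfg)
  refine ⟨f, hfNF, ?_, ?_⟩
  · intro s hs
    have hs0 : 0 < s.re := d.cast_nonneg.trans_lt hs
    have h3 : (d : ℝ) - (3 : ℕ) < s.re := by push_cast; linarith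
    have hden : ∀ k : ℕ, s + k - d ≠ 0 := by
      intro k hk
      have := congrArg Complex.re hk
      simp at this
      have hk : (0 : ℝ) ≤ k := k.cast_nonneg
      linarith
    have hval : f s = (Complex.Gamma s)⁻¹ * mellinCont c d F 3 s := by
      refine (hloc s (fun z => (Complex.Gamma z)⁻¹ * mellinCont c d F 3 z) ?_ ?_).eq_of_nhds
      · refine (hΓ s).mul (AnalyticAt.add ?_ (h.analyticAt le_rfl h3))
        exact Finset.analyticAt_fun_sum _ fun k _ =>
          analyticAt_const.fun_div (by fun_prop) (hden k)
      · refine EventuallyEq.filter_mono ?_ nhdsWithin_le_nhds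
        filter_upwards [hopen 3 s h3] with z hz
        exact hf₀N 3 le_rfl z hz
    have := hasSum_mellin (a := fun _ => 1) (fun i => Or.inr (hp i)) hs0
      (by simpa using hF) (by simpa using hsum s.re hs)
    rw [hval, ← h.mellin_eq le_rfl hs]
    have hG := Complex.Gamma_ne_zero_of_re_pos hs0
    refine (this.mul_left (Complex.Gamma s)⁻¹).congr_fun fun i => ?_
    rw [Complex.cpow_neg]
    field_simp
  -- With `N = d + 3` terms, only `c_d / s` is singular at `0`. Times `1/Γ(s)` it becomes `c_d / Γ(s
  -- + 1)`, with value `c_d`; the regular terms, indices below `d` and the remainder in `A`, the two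
  -- indices above `d` in `B`, are killed by the zero of `1/Γ`.
  · set A : ℂ → ℂ := fun s => ∑ k ∈ Finset.range d, c k / (s + k - d) +
      mellin (cutRemainder c d F (d + 3)) s with hA
    set B : ℂ → ℂ := fun s => ∑ k ∈ Finset.range 2, c (d + 1 + k) / (s + 1 + k) with hB
    have h3 : (d : ℝ) - (d + 3 : ℕ) < (0 : ℂ).re := by push_cast; simp
    have hg : AnalyticAt ℂ (fun s => (Complex.Gamma s)⁻¹ * (A s + B s) +
        c d * (Complex.Gamma (s + 1))⁻¹) 0 := by
      refine ((hΓ 0).mul (AnalyticAt.add (AnalyticAt.add ?_ (h.analyticAt (by omega) h3)) ?_)).add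
        (analyticAt_const.mul ?_)
      · refine Finset.analyticAt_fun_sum _ fun k hk =>
          analyticAt_const.fun_div (by fun_prop) ?_
        rw [zero_add, sub_ne_zero]
        exact_mod_cast (Finset.mem_range.mp hk).ne
      · refine Finset.analyticAt_fun_sum _ fun k hk =>
          analyticAt_const.fun_div (by fun_prop) ?_
        rw [zero_add]
        exact_mod_cast (by omega : 1 + k ≠ 0)
      · exact AnalyticAt.fun_comp (g := fun s => (Complex.Gamma s)⁻¹) (hΓ (0 + 1)) (by fun_prop)
    have hfg := hloc 0 _ hg (by
      rw [EventuallyEq, eventually_nhdsWithin_iff]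
      filter_upwards [hopen (d + 3) 0 h3] with s hs hs0
      rw [hf₀N (d + 3) (by omega) s hs, mellinCont, Finset.sum_range_add, hA, hB,
        Complex.Gamma_add_one s hs0, Finset.sum_range_succ']
      simp only [Finset.sum_range_succ, Finset.sum_range_zero]
      have hs0' : s ≠ 0 := hs0
      push_cast
      have e3 : d + 1 + 1 = d + (1 + 1) := by ring
      simp only [e3, add_zero, zero_add, mul_inv]
      ring)
    refine ⟨(analyticAt_congr hfg).mpr hg, ?_⟩
    rw [hfg.eq_of_nhds]
    -- `Complex.Gamma 0` has the default value `0`, and `0⁻¹ = 0` is the true value of the entire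
    -- function `1/Γ` there.
    simp [Complex.Gamma_zero]

/-- Two functions that are meromorphic off a set not disconnecting the plane agree near every other
point, up to the value there, if they agree near one point. -/
theorem eventuallyEq_of_meromorphicOn {U : Set ℂ} (hU : IsPreconnected U) {f g : ℂ → ℂ}
    (hf : MeromorphicOn f U) (hg : MeromorphicOn g U) {s₀ s : ℂ} (hs₀ : s₀ ∈ U) (hs : s ∈ U)
    (h : f =ᶠ[𝓝 s₀] g) : f =ᶠ[𝓝[≠] s] g := by
  by_contra hne
  have h1 : meromorphicOrderAt (f - g) s ≠ ⊤ := by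
    intro htop
    apply hne
    rw [meromorphicOrderAt_eq_top_iff] at htop
    filter_upwards [htop] with z hz
    exact sub_eq_zero.mp hz
  -- Finiteness of the order of `f - g` propagates along a preconnected set, but the order at `s₀`
  -- is infinite.
  have h2 := (hf.sub hg).meromorphicOrderAt_ne_top_of_isPreconnected hU hs hs₀ h1
  apply h2
  rw [meromorphicOrderAt_eq_top_iff]
  filter_upwards [h.filter_mono nhdsWithin_le_nhds] with z hz
  exact sub_eq_zero.mpr hz

end Continuation

/-! ### Barnes and Hurwitz zeta values at `0`. -/

section Zeta

open Filter Topology Set Asymptotics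

/-- The geometric series `∑ₙ exp (-n w t) = 1 / (1 - exp (-w t))`. -/
noncomputable def expGeom (w t : ℝ) : ℝ := (1 - Real.exp (-(w * t)))⁻¹

lemma one_sub_exp_ne_zero {w t : ℝ} (hw : 0 < w) (ht : 0 < t) : 1 - Real.exp (-(w * t)) ≠ 0 := by
  have : Real.exp (-(w * t)) < 1 := by
    rw [Real.exp_lt_one_iff]
    have := mul_pos hw ht
    linarith
  linarith

lemma hasSum_expGeom {w t : ℝ} (hw : 0 < w) (ht : 0 < t) :
    HasSum (fun n : ℕ => Real.exp (-(n * w * t))) (expGeom w t) := by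
  have h1 : Real.exp (-(w * t)) < 1 := by
    rw [Real.exp_lt_one_iff]
    have := mul_pos hw ht
    linarith
  refine (hasSum_geometric_of_lt_one (Real.exp_pos _).le h1).congr_fun fun n => ?_
  rw [← Real.exp_nat_mul]
  congr 1
  ring

lemma continuousOn_expGeom {w : ℝ} (hw : 0 < w) : ContinuousOn (expGeom w) (Ioi 0) := by
  refine ContinuousOn.inv₀ (by fun_prop) fun t ht => one_sub_exp_ne_zero hw ht

lemma tendsto_expGeom {w : ℝ} (hw : 0 < w) : Tendsto (expGeom w) atTop (𝓝 1) := by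
  have h1 : Tendsto (fun t : ℝ => Real.exp (-(w * t))) atTop (𝓝 0) :=
    Real.tendsto_exp_neg_atTop_nhds_zero.comp (tendsto_id.const_mul_atTop hw)
  have h2 := (tendsto_const_nhds (x := (1 : ℝ))).sub h1
  rw [sub_zero] at h2
  have h3 := h2.inv₀ one_ne_zero
  rw [inv_one] at h3
  exact h3

lemma expGeom_eq_toddFun {w t : ℝ} (hw : 0 < w) (ht : 0 < t) :
    (expGeom w t : ℂ) = toddFun (w * t) / (w * t) := by
  have h0 : (w : ℂ) * t ≠ 0 := by exact_mod_cast (mul_pos hw ht).ne'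
  have h1 : (1 : ℂ) - Complex.exp (-(w * t)) ≠ 0 := by
    exact_mod_cast one_sub_exp_ne_zero hw ht
  rw [toddFun, if_neg h0, expGeom]
  push_cast
  rw [div_right_comm, div_self h0, one_div]

/-- The factor `exp (-z t)` supplies the decay, since `q`, a product of geometric series in the
applications, is bounded at infinity. -/
lemma HasJet.exists_hasExpansion {g : ℂ → ℂ} {a₀ a₁ a₂ : ℂ} (hg : HasJet g a₀ a₁ a₂) (d : ℕ)
    {z : ℝ} (hz : 0 < z) {q : ℝ → ℝ} (hq : ContinuousOn q (Ioi 0)) (hq' : Tendsto q atTop (𝓝 1))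
    (h : ∀ t : ℝ, 0 < t → ((Real.exp (-z * t) * q t : ℝ) : ℂ) = g t / t ^ d) :
    ∃ c : ℕ → ℂ, c 0 = a₀ ∧ c 1 = a₁ ∧ c 2 = a₂ ∧
      HasExpansion c d fun t => ((Real.exp (-z * t) * q t : ℝ) : ℂ) := by
  obtain ⟨c, h0, h1, h2, hc⟩ := hg.exists_coeff
  refine ⟨c, h0, h1, h2, ⟨?_, ⟨z, hz, ?_⟩, ?_⟩⟩
  · exact Complex.continuous_ofReal.comp_continuousOn (ContinuousOn.mul (by fun_prop) hq)
  · have h3 : q =O[atTop] fun _ => (1 : ℝ) := hq'.isBigO_one ℝ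
    have h4 := (isBigO_refl (fun t : ℝ => Real.exp (-z * t)) atTop).mul h3
    simp only [mul_one] at h4
    refine IsBigO.of_norm_left (h4.norm_left.congr_left fun t => ?_)
    rw [Complex.norm_real]
  · intro N hN
    obtain ⟨r, hr, he⟩ := hc N hN
    refine ⟨r, hr, ?_⟩
    have ht : Tendsto (fun t : ℝ => (t : ℂ)) (𝓝[>] 0) (𝓝 0) :=
      (Complex.continuous_ofReal.tendsto' 0 0 (by simp)).mono_left nhdsWithin_le_nhds
    filter_upwards [ht.eventually he, self_mem_nhdsWithin] with t h1 h2
    rw [h t h2, h1]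

/-- Comparison with an Eisenstein series over `ℤ²`: with `c = min(z, w₁, w₂)` the linear form is at
least `c` times the sup norm of `(m + 1, n + 1)`. The shift by one avoids the origin and is paid for
by `z`. -/
lemma summable_one_div_linear_rpow {z w₁ w₂ : ℝ} (hz : 0 < z) (h₁ : 0 < w₁) (h₂ : 0 < w₂) {σ : ℝ}
    (hσ : 2 < σ) : Summable fun i : ℕ × ℕ => 1 / (z + i.1 * w₁ + i.2 * w₂) ^ σ := by
  set c := min z (min w₁ w₂) with hc
  have hc0 : 0 < c := lt_min hz (lt_min h₁ h₂)
  have hinj : Function.Injective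
      (fun i : ℕ × ℕ => (![(i.1 : ℤ) + 1, (i.2 : ℤ) + 1] : Fin 2 → ℤ)) := by
    intro i j hij
    have e0 := congrFun hij 0
    have e1 := congrFun hij 1
    simp at e0 e1
    exact Prod.ext e0 e1
  have hs := ((EisensteinSeries.summable_one_div_norm_rpow hσ).comp_injective hinj).mul_left
    (c ^ (-σ))
  refine Summable.of_nonneg_of_le (fun i => by positivity) (fun i => ?_) hs
  set y : Fin 2 → ℤ := ![(i.1 : ℤ) + 1, (i.2 : ℤ) + 1] with hy
  have hcz : c ≤ z := min_le_left _ _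
  have hc1 : c ≤ w₁ := (min_le_right _ _).trans (min_le_left _ _)
  have hc2 : c ≤ w₂ := (min_le_right _ _).trans (min_le_right _ _)
  have hi1 : (0 : ℝ) ≤ i.1 := Nat.cast_nonneg _
  have hi2 : (0 : ℝ) ≤ i.2 := Nat.cast_nonneg _
  have hlow : c + i.1 * c + i.2 * c ≤ z + i.1 * w₁ + i.2 * w₂ := by gcongr
  have hny : ‖y‖ ≤ 1 + i.1 + i.2 := by
    rw [pi_norm_le_iff_of_nonneg (by positivity)]
    intro k
    have e : ∀ n : ℕ, ‖(n : ℤ) + 1‖ = (n : ℝ) + 1 := fun n => by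
      rw [Int.norm_eq_abs]
      push_cast
      exact abs_of_nonneg (by positivity)
    fin_cases k
    · simp only [hy, Fin.zero_eta, Matrix.cons_val_zero, e]
      linarith
    · simp only [hy, Fin.mk_one, Matrix.cons_val_one, Matrix.cons_val_fin_one, e]
      linarith
  have hny0 : 0 < ‖y‖ := by
    rw [norm_pos_iff]
    intro h0
    have := congrFun h0 0
    simp [hy] at this
    omega
  have hle : c * ‖y‖ ≤ z + i.1 * w₁ + i.2 * w₂ :=
    (mul_le_mul_of_nonneg_left hny hc0.le).trans (by linarith)
  simp only [Function.comp_apply, ← hy]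
  rw [← Real.mul_rpow hc0.le hny0.le, Real.rpow_neg (by positivity), ← one_div]
  exact one_div_le_one_div_of_le (by positivity)
    (Real.rpow_le_rpow (by positivity) hle (by linarith))

/-- The exponential sum factors as `exp(-zt)` times two geometric series, that is, `exp(-zt)` times
two Todd functions over `w₀ w₁ t²`. The value at `0` is therefore the `t²` coefficient of the
numerator over `w₀ w₁`. -/
theorem exists_isBarnesZeta2 {z : ℝ} {w : Fin 2 → ℝ} (hz : 0 < z) (h₀ : 0 < w 0) (h₁ : 0 < w 1) :
    ∃ f, IsBarnesZeta2 z w f ∧ AnalyticAt ℂ f 0 ∧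
      f 0 = ((z ^ 2 / (2 * w 0 * w 1) - z * (w 0 + w 1) / (2 * w 0 * w 1)
        + (w 0 ^ 2 + w 1 ^ 2 + 3 * w 0 * w 1) / (12 * w 0 * w 1) : ℝ) : ℂ) := by
  have hw0 : (w 0 : ℂ) ≠ 0 := by exact_mod_cast h₀.ne'
  have hw1 : (w 1 : ℂ) ≠ 0 := by exact_mod_cast h₁.ne'
  have hjet := ((hasJet_exp (-z)).mul ((hasJet_toddFun.comp_mul (w 0)).mul
    (hasJet_toddFun.comp_mul (w 1)))).const_mul (1 / ((w 0 : ℂ) * w 1))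
  obtain ⟨c, -, -, hc2, hexp⟩ := hjet.exists_hasExpansion 2 hz
    (q := fun t => expGeom (w 0) t * expGeom (w 1) t)
    ((continuousOn_expGeom h₀).mul (continuousOn_expGeom h₁))
    (by simpa using (tendsto_expGeom h₀).mul (tendsto_expGeom h₁)) (by
      intro t ht
      have ht0 : (t : ℂ) ≠ 0 := by exact_mod_cast ht.ne'
      rw [Complex.ofReal_mul, Complex.ofReal_mul, expGeom_eq_toddFun h₀ ht,
        expGeom_eq_toddFun h₁ ht]
      push_cast
      field_simp)
  obtain ⟨f, hf1, hf2, hf3, hf4⟩ := hexp.exists_continuation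
    (p := fun i : ℕ × ℕ => z + i.1 * w 0 + i.2 * w 1) (fun i => by positivity) (by
      intro t ht
      have h := (hasSum_expGeom h₀ ht).mul (hasSum_expGeom h₁ ht)
        ((hasSum_expGeom h₀ ht).summable.mul_of_nonneg (hasSum_expGeom h₁ ht).summable
          (fun _ => (Real.exp_pos _).le) (fun _ => (Real.exp_pos _).le))
      have h' := Complex.hasSum_ofReal.mpr (h.mul_left (Real.exp (-z * t)))
      refine h'.congr_fun fun i => ?_
      rw [← Real.exp_add, ← Real.exp_add]
      congr 2
      ring) (fun σ hσ => summable_one_div_linear_rpow hz h₀ h₁ (by exact_mod_cast hσ))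
  refine ⟨f, ⟨hf1, fun s hs => hf2 s (by exact_mod_cast hs)⟩, hf3, ?_⟩
  rw [hf4, hc2]
  push_cast
  field_simp
  ring

/-- By the identity theorem from `Re s > 2`; the normal form upgrades agreement on punctured
neighbourhoods. It makes the arbitrary choice in `barnesZeta2` harmless. -/
theorem IsBarnesZeta2.eventuallyEq {z : ℝ} {w : Fin 2 → ℝ} {f g : ℂ → ℂ} (hf : IsBarnesZeta2 z w f)
    (hg : IsBarnesZeta2 z w g) (s : ℂ) : f =ᶠ[𝓝 s] g := by
  rw [← (hf.1 (mem_univ s)).eventuallyEq_nhdsNE_iff_eventuallyEq_nhds (hg.1 (mem_univ s))]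
  refine eventuallyEq_of_meromorphicOn isPreconnected_univ hf.1.meromorphicOn hg.1.meromorphicOn
    (mem_univ (3 : ℂ)) (mem_univ s) ?_
  have : ∀ᶠ z : ℂ in 𝓝 3, 2 < z.re :=
    (isOpen_lt continuous_const Complex.continuous_re).mem_nhds (by norm_num)
  filter_upwards [this] with u hu
  exact (hf.2 u hu).unique (hg.2 u hu)

/-- The Barnes double zeta function exists and is analytic at `0`, where its value is
`B₂,₂(z) / 2`. -/
theorem barnesZeta2_spec {z : ℝ} {w : Fin 2 → ℝ} (hz : 0 < z) (h₀ : 0 < w 0) (h₁ : 0 < w 1) :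
    IsBarnesZeta2 z w (barnesZeta2 z w) ∧ AnalyticAt ℂ (barnesZeta2 z w) 0 ∧
      barnesZeta2 z w 0 = ((z ^ 2 / (2 * w 0 * w 1) - z * (w 0 + w 1) / (2 * w 0 * w 1)
        + (w 0 ^ 2 + w 1 ^ 2 + 3 * w 0 * w 1) / (12 * w 0 * w 1) : ℝ) : ℂ) := by
  obtain ⟨f, hf, hfa, hf0⟩ := exists_isBarnesZeta2 hz h₀ h₁
  have hb : IsBarnesZeta2 z w (barnesZeta2 z w) := Classical.epsilon_spec ⟨f, hf⟩
  have h := hb.eventuallyEq hf 0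
  exact ⟨hb, (analyticAt_congr h).mpr hfa, h.eq_of_nhds.trans hf0⟩

/-- The value at `0` of the Hurwitz zeta function. -/
theorem hurwitzZeta_apply_zero {u : ℝ} (hu : 0 < u) (hu1 : u ≤ 1) :
    HurwitzZeta.hurwitzZeta (u : UnitAddCircle) 0 = ((1 / 2 - u : ℝ) : ℂ) := by
  have hjet := (hasJet_exp (-u)).mul hasJet_toddFun
  obtain ⟨c, -, hc1, -, hexp⟩ := hjet.exists_hasExpansion 1 hu (continuousOn_expGeom one_pos)
    (tendsto_expGeom one_pos) (by
      intro t ht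
      have ht0 : (t : ℂ) ≠ 0 := by exact_mod_cast ht.ne'
      rw [Complex.ofReal_mul, expGeom_eq_toddFun one_pos ht]
      push_cast
      rw [one_mul]
      field_simp)
  obtain ⟨f, hf1, hf2, hf3, hf4⟩ := hexp.exists_continuation (p := fun n : ℕ => u + n)
    (fun i => by positivity) (by
      intro t ht
      have h' := Complex.hasSum_ofReal.mpr ((hasSum_expGeom one_pos ht).mul_left
        (Real.exp (-u * t)))
      refine h'.congr_fun fun i => ?_
      rw [← Real.exp_add]
      congr 2
      ring) (by
      intro σ hσ
      have h := (Real.summable_one_div_nat_add_rpow u σ).mpr (by exact_mod_cast hσ)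
      refine h.congr fun n => ?_
      rw [abs_of_pos (by positivity), add_comm])
  have hhz : ∀ s : ℂ, s ≠ 1 →
      AnalyticAt ℂ (HurwitzZeta.hurwitzZeta (u : UnitAddCircle)) s := fun s hs =>
    DifferentiableOn.analyticAt (s := {1}ᶜ) (fun z hz =>
      (HurwitzZeta.differentiableAt_hurwitzZeta _ hz).differentiableWithinAt)
      (isOpen_compl_singleton.mem_nhds hs)
  -- Analyticity of the Hurwitz zeta function is used only off `1`; the punctured plane is still
  -- connected and joins `2` to `0`.
  have hU : IsPreconnected ({1}ᶜ : Set ℂ) :=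
    (isConnected_compl_singleton_of_one_lt_rank (by simp) 1).isPreconnected
  have hev : f =ᶠ[𝓝 2] HurwitzZeta.hurwitzZeta (u : UnitAddCircle) := by
    have : ∀ᶠ z : ℂ in 𝓝 2, 1 < z.re :=
      (isOpen_lt continuous_const Complex.continuous_re).mem_nhds (by norm_num)
    filter_upwards [this] with s hs
    refine (hf2 s (by exact_mod_cast hs)).unique ?_
    refine (HurwitzZeta.hasSum_hurwitzZeta_of_one_lt_re ⟨hu.le, hu1⟩ hs).congr_fun fun n => ?_
    rw [Complex.cpow_neg, one_div]
    push_cast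
    rw [add_comm]
  have h0 := eventuallyEq_of_meromorphicOn hU (hf1.meromorphicOn.mono_set (subset_univ _))
    (fun s hs => (hhz s hs).meromorphicAt) (by simp : (2 : ℂ) ∈ ({1}ᶜ : Set ℂ))
    (by simp : (0 : ℂ) ∈ ({1}ᶜ : Set ℂ)) hev
  have h1 := (hf3.meromorphicNFAt.eventuallyEq_nhdsNE_iff_eventuallyEq_nhds
    (hhz 0 zero_ne_one).meromorphicNFAt).mp h0
  rw [← h1.eq_of_nhds, hf4, hc1]
  push_cast
  ring

end Zeta

/-! ### Distribution relations and the three-term relation of Bernoulli functions. -/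

section Bernoulli

lemma mem_intSet_iff {y : ℝ} : y ∈ intSet ↔ Int.fract y = 0 := by
  rw [Int.fract_eq_zero_iff, intSet]

lemma indZ_eq (y : ℝ) : indZ y = if Int.fract y = 0 then 1 else 0 := by
  classical
  rw [indZ, Set.indicator_apply]
  simp [mem_intSet_iff]

lemma bernBar1_eq (y : ℝ) : bernBar1 y = Int.fract y - 1 / 2 + indZ y / 2 := by
  rw [bernBar1, indZ_eq, mem_intSet_iff]
  split_ifs with h
  · rw [h]; norm_num
  · ring

lemma indZ_add_one (y : ℝ) : indZ (y + 1) = indZ y := by simp [indZ_eq]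

lemma bernBar1_add_one (y : ℝ) : bernBar1 (y + 1) = bernBar1 y := by
  simp [bernBar1_eq, indZ_add_one]

lemma bernBar2_add_one (y : ℝ) : bernBar2 (y + 1) = bernBar2 y := by simp [bernBar2]

lemma indZ_periodic : Function.Periodic indZ 1 := indZ_add_one
lemma bernBar1_periodic : Function.Periodic bernBar1 1 := bernBar1_add_one
lemma bernBar2_periodic : Function.Periodic bernBar2 1 := bernBar2_add_one

lemma fract_neg_eq_zero {y : ℝ} : Int.fract (-y) = 0 ↔ Int.fract y = 0 := by
  rw [← mem_intSet_iff, ← mem_intSet_iff]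
  constructor
  · rintro ⟨n, hn⟩
    exact ⟨-n, by push_cast; linarith⟩
  · rintro ⟨n, hn⟩
    exact ⟨-n, by push_cast; linarith⟩

lemma indZ_neg (y : ℝ) : indZ (-y) = indZ y := by simp [indZ_eq]

lemma bernBar1_neg (y : ℝ) : bernBar1 (-y) = -bernBar1 y := by
  rw [bernBar1, bernBar1, mem_intSet_iff, mem_intSet_iff, fract_neg_eq_zero]
  split_ifs with h
  · simp
  · rw [Int.fract_neg h]; ring

lemma bernBar2_neg (y : ℝ) : bernBar2 (-y) = bernBar2 y := by
  rw [bernBar2, bernBar2]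
  rcases eq_or_ne (Int.fract y) 0 with h | h
  · rw [h, fract_neg_eq_zero.mpr h]
  · rw [Int.fract_neg h]; ring

/-- Shifting `x` by one only moves the term `m = 0` to `m = k`. Distribution relations can hence be
checked for `0 ≤ x < 1`, where all fractional parts are explicit. -/
lemma periodic_sum_div {f : ℝ → ℝ} (hf : Function.Periodic f 1) {k : ℕ} (hk : 0 < k) :
    Function.Periodic (fun x => ∑ m ∈ Finset.range k, f ((x + m) / k)) 1 := by
  intro x
  have hk' : (k : ℝ) ≠ 0 := by exact_mod_cast hk.ne'
  have h1 := Finset.sum_range_succ (fun m : ℕ => f ((x + m) / k)) k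
  have h2 := Finset.sum_range_succ' (fun m : ℕ => f ((x + m) / k)) k
  have h3 : f ((x + k) / k) = f ((x + (0 : ℕ)) / k) := by
    rw [add_div, div_self hk', hf]
    simp
  rw [h3] at h1
  have h4 := h1.symm.trans h2
  rw [add_left_inj] at h4
  dsimp only
  rw [h4]
  refine Finset.sum_congr rfl fun m _ => ?_
  push_cast
  ring_nf

lemma periodic_apply_fract {f : ℝ → ℝ} (hf : Function.Periodic f 1) (x : ℝ) :
    f (Int.fract x) = f x := by
  rw [Int.fract]
  simpa using hf.sub_int_mul_eq ⌊x⌋ (x := x)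

lemma fract_div_of_lt {x : ℝ} (h0 : 0 ≤ x) (h1 : x < 1) {k m : ℕ} (hm : m < k) :
    Int.fract ((x + m) / k) = (x + m) / k := by
  have hk : (0 : ℝ) < k := by exact_mod_cast (Nat.zero_le m).trans_lt hm
  rw [Int.fract_eq_self]
  refine ⟨by positivity, (div_lt_one hk).mpr ?_⟩
  have : (m : ℝ) + 1 ≤ k := by exact_mod_cast hm
  linarith

lemma sum_range_add (x : ℝ) (k : ℕ) :
    ∑ m ∈ Finset.range k, (x + m) = k * x + k * (k - 1) / 2 := by
  induction k with
  | zero => simp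
  | succ k ih => rw [Finset.sum_range_succ, ih]; push_cast; ring

lemma sum_range_add_sq (x : ℝ) (k : ℕ) :
    ∑ m ∈ Finset.range k, (x + m) ^ 2
      = k * x ^ 2 + k * (k - 1) * x + k * (k - 1) * (2 * k - 1) / 6 := by
  induction k with
  | zero => simp
  | succ k ih => rw [Finset.sum_range_succ, ih]; push_cast; ring

lemma sum_bernBar2_nat (x : ℝ) {k : ℕ} (hk : 0 < k) :
    ∑ m ∈ Finset.range k, bernBar2 ((x + m) / k) = bernBar2 x / k := by
  have hk' : (k : ℝ) ≠ 0 := by exact_mod_cast hk.ne'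
  rw [← periodic_apply_fract (periodic_sum_div bernBar2_periodic hk) x,
    Finset.sum_congr rfl fun m hm => by
      rw [bernBar2, fract_div_of_lt (Int.fract_nonneg x) (Int.fract_lt_one x)
        (Finset.mem_range.mp hm), div_pow]]
  rw [Finset.sum_add_distrib, Finset.sum_sub_distrib, ← Finset.sum_div, ← Finset.sum_div,
    sum_range_add_sq, sum_range_add, Finset.sum_const, Finset.card_range, nsmul_eq_mul, bernBar2]
  field_simp
  ring

lemma sum_indZ_nat (x : ℝ) {k : ℕ} (hk : 0 < k) :
    ∑ m ∈ Finset.range k, indZ ((x + m) / k) = indZ x := by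
  have hk' : (0 : ℝ) < k := by exact_mod_cast hk
  have hx := Int.fract_nonneg x
  rw [← periodic_apply_fract (periodic_sum_div indZ_periodic hk) x,
    Finset.sum_congr rfl fun m hm => by
      rw [indZ_eq, fract_div_of_lt hx (Int.fract_lt_one x) (Finset.mem_range.mp hm)],
    Finset.sum_eq_single_of_mem 0 (Finset.mem_range.mpr hk), indZ_eq]
  · simp [hk.ne']
  · intro m _ hm
    rw [if_neg]
    have : (0 : ℝ) < m := by exact_mod_cast Nat.pos_of_ne_zero hm
    positivity

lemma sum_bernBar1_nat (x : ℝ) {k : ℕ} (hk : 0 < k) :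
    ∑ m ∈ Finset.range k, bernBar1 ((x + m) / k) = bernBar1 x := by
  have hk' : (k : ℝ) ≠ 0 := by exact_mod_cast hk.ne'
  have hfr : Function.Periodic (Int.fract : ℝ → ℝ) 1 := fun y => Int.fract_add_one y
  have h1 : ∑ m ∈ Finset.range k, Int.fract ((x + m) / k) = Int.fract x + (k - 1) / 2 := by
    rw [← periodic_apply_fract (periodic_sum_div hfr hk) x,
      Finset.sum_congr rfl fun m hm => fract_div_of_lt (Int.fract_nonneg x) (Int.fract_lt_one x)
        (Finset.mem_range.mp hm), ← Finset.sum_div, sum_range_add]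
    field_simp
  simp only [bernBar1_eq]
  rw [Finset.sum_add_distrib, Finset.sum_sub_distrib, ← Finset.sum_div _ (fun m : ℕ => indZ ((x + m) / k)), sum_indZ_nat x hk, h1, Finset.sum_const, Finset.card_range, nsmul_eq_mul]
  ring

/-- Reduces negative denominators to positive ones by parity: `bernBar2` and `indZ` are even, while
the odd `bernBar1` contributes the sign of `n`. -/
lemma natAbs_cases {n : ℤ} (hn : n ≠ 0) :
    0 < n.natAbs ∧ ((n : ℝ) = n.natAbs ∧ Real.sign n = 1 ∨ (n : ℝ) = -n.natAbs ∧ Real.sign n = -1) := by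
  refine ⟨Int.natAbs_pos.mpr hn, ?_⟩
  rcases lt_or_gt_of_ne hn with h | h
  · right
    refine ⟨?_, Real.sign_of_neg (by exact_mod_cast h)⟩
    rw [Nat.cast_natAbs, Int.cast_abs, abs_of_neg (by exact_mod_cast h), neg_neg]
  · left
    refine ⟨?_, Real.sign_of_pos (by exact_mod_cast h)⟩
    rw [Nat.cast_natAbs, Int.cast_abs, abs_of_pos (by exact_mod_cast h)]

lemma sum_bernBar2 (x : ℝ) {n : ℤ} (hn : n ≠ 0) :
    ∑ m ∈ Finset.range n.natAbs, bernBar2 ((x + m) / n) = bernBar2 x / n.natAbs := by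
  obtain ⟨hk, ⟨h, -⟩ | ⟨h, -⟩⟩ := natAbs_cases hn
  · rw [h]; exact sum_bernBar2_nat x hk
  · rw [h]
    simp only [div_neg, bernBar2_neg]
    exact sum_bernBar2_nat x hk

lemma sum_bernBar1 (x : ℝ) {n : ℤ} (hn : n ≠ 0) :
    ∑ m ∈ Finset.range n.natAbs, bernBar1 ((x + m) / n) = Real.sign n * bernBar1 x := by
  obtain ⟨hk, ⟨h, h'⟩ | ⟨h, h'⟩⟩ := natAbs_cases hn
  · rw [h', h, one_mul]; exact sum_bernBar1_nat x hk
  · rw [h', h]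
    simp only [div_neg, bernBar1_neg, Finset.sum_neg_distrib]
    rw [sum_bernBar1_nat x hk]
    ring

lemma sum_indZ (x : ℝ) {n : ℤ} (hn : n ≠ 0) :
    ∑ m ∈ Finset.range n.natAbs, indZ ((x + m) / n) = indZ x := by
  obtain ⟨hk, ⟨h, -⟩ | ⟨h, -⟩⟩ := natAbs_cases hn
  · rw [h]; exact sum_indZ_nat x hk
  · rw [h]
    simp only [div_neg, indZ_neg]
    exact sum_indZ_nat x hk

lemma sum_range_eq_sum_zmod {n : ℕ} [NeZero n] (f : ZMod n → ℝ) (g : ℕ) :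
    ∑ j ∈ Finset.range (g * n), f j = g * ∑ u, f u := by
  have h1 : ∑ j ∈ Finset.range n, f j = ∑ u, f u :=
    Finset.sum_nbij' (fun j => (j : ZMod n)) ZMod.val (by simp)
      (fun u _ => Finset.mem_range.mpr (ZMod.val_lt u))
      (fun j hj => ZMod.val_cast_of_lt (Finset.mem_range.mp hj))
      (fun u _ => ZMod.natCast_zmod_val u) (fun _ _ => rfl)
  induction g with
  | zero => simp
  | succ g ih =>
    rw [add_mul, one_mul, Finset.sum_range_add, ih]
    simp only [Nat.cast_add, Nat.cast_mul, CharP.cast_eq_zero, mul_zero, zero_add]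
    rw [h1]
    push_cast
    ring

/-- The distribution relation of the second Bernoulli function along the multiples of `a / c`. -/
lemma sum_bernBar2_lattice (a : ℤ) {c : ℤ} (hc : c ≠ 0) (x₀ x₁ : ℝ) :
    ∑ j ∈ Finset.range c.natAbs, bernBar2 (x₀ + (x₁ + j) * (((-a : ℤ) : ℝ) / c))
      = (Int.gcd a c : ℝ) ^ 2 / c.natAbs *
        bernBar2 (c / (Int.gcd a c : ℝ) * x₀ - a / (Int.gcd a c : ℝ) * x₁) := by
  obtain ⟨g, a', c', hg, hcop, ha', hc'⟩ :=
    Int.exists_gcd_one' (m := a) (n := c) (Int.gcd_pos_of_ne_zero_right a hc)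
  have hgcd : Int.gcd a c = g := by
    rw [ha', hc', Int.gcd_mul_right, hcop]; simp
  have hc'0 : c' ≠ 0 := by rintro rfl; simp at hc'; exact hc hc'
  have hgr : (g : ℝ) ≠ 0 := by exact_mod_cast hg.ne'
  have hc'r : (c' : ℝ) ≠ 0 := by exact_mod_cast hc'0
  set n := c'.natAbs with hn
  have hnpos : 0 < n := Int.natAbs_pos.mpr hc'0
  have : NeZero n := ⟨hnpos.ne'⟩
  have hnr : (n : ℝ) ≠ 0 := by exact_mod_cast hnpos.ne'
  have hcn : c.natAbs = g * n := by rw [hc', Int.natAbs_mul, Int.natAbs_natCast, mul_comm]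
  have hcr : (c : ℝ) = g * c' := by rw [hc']; push_cast; ring
  have har : (a : ℝ) = g * a' := by rw [ha']; push_cast; ring
  set X : ℝ := c' * x₀ - a' * x₁ with hX
  -- The `j`-th summand is `F (-a' j)`, and `F` is periodic modulo `n = |c'|`.
  set F : ℤ → ℝ := fun k => bernBar2 ((X + k) / c') with hF
  have hper : Function.Periodic F (n : ℤ) := by
    intro k
    simp only [hF]
    obtain ⟨-, ⟨h, -⟩ | ⟨h, -⟩⟩ := natAbs_cases hc'0
    · rw [← bernBar2_add_one ((X + k) / c')]
      congr 1
      push_cast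
      rw [← hn] at h
      rw [← h]
      field_simp
      ring
    · rw [← bernBar2_add_one ((X + (k + n : ℤ)) / c')]
      congr 1
      push_cast
      rw [← hn] at h
      rw [(by linarith : (n : ℝ) = -c')]
      field_simp
      ring
  have hval : ∀ k : ℤ, F k = F ((k : ZMod n).val) := by
    intro k
    rw [ZMod.val_intCast]
    have := hper.int_mul (k / n) (k % n)
    rw [← this]
    congr 1
    rw [mul_comm]
    exact (Int.emod_add_mul_ediv k n).symm
  -- As `a'` is prime to `c'`, the map `j ↦ -a' j` permutes `ℤ/n`, so the sum is `g` copies of the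
  -- ordinary distribution relation; `g / n = g² / |c|`.
  have hunit : IsUnit ((-a' : ℤ) : ZMod n) := by
    rw [ZMod.coe_int_isUnit_iff_isCoprime, IsCoprime.neg_right_iff]
    have h1 : IsCoprime c' a' := (Int.isCoprime_iff_gcd_eq_one.mpr hcop).symm
    rcases Int.natAbs_eq c' with h | h
    · rw [h] at h1; exact h1
    · rw [h] at h1; exact (IsCoprime.neg_left_iff _ _).mp h1
  have hterm : ∀ j ∈ Finset.range c.natAbs,
      bernBar2 (x₀ + (x₁ + j) * (((-a : ℤ) : ℝ) / c))
        = (fun u : ZMod n => F ((((-a' : ℤ) : ZMod n) * u).val)) (j : ZMod n) := by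
    intro j _
    dsimp only
    have : ((-a' : ℤ) : ZMod n) * (j : ZMod n) = ((-a' * j : ℤ) : ZMod n) := by push_cast; rfl
    rw [this, ← hval, hF]
    dsimp only
    congr 1
    rw [hcr]
    push_cast
    rw [har, hX]
    field_simp
    ring
  rw [Finset.sum_congr rfl hterm, hcn,
    sum_range_eq_sum_zmod (fun u : ZMod n => F ((((-a' : ℤ) : ZMod n) * u).val))]
  have hbij : ∑ u : ZMod n, F ((((-a' : ℤ) : ZMod n) * u).val) = ∑ u : ZMod n, F (u.val) :=
    Fintype.sum_bijective (fun u => ((-a' : ℤ) : ZMod n) * u)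
      (Finite.injective_iff_bijective.mp hunit.mul_right_injective) _ _ (fun _ => rfl)
  have hsum : ∑ u : ZMod n, F (u.val) = bernBar2 X / n := by
    have h1 := sum_range_eq_sum_zmod (n := n) (fun u => F (u.val)) 1
    rw [one_mul, Nat.cast_one, one_mul] at h1
    rw [← h1, ← sum_bernBar2 X hc'0]
    refine Finset.sum_congr rfl fun j _ => ?_
    have := hval j
    rw [Int.cast_natCast] at this
    rw [← this, hF]
    simp
  rw [hbij, hsum, hgcd, hcr, har]
  have e : (g : ℝ) * c' / g * x₀ - g * a' / g * x₁ = X := by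
    rw [hX]; field_simp
  rw [e]
  push_cast
  field_simp

/-- The three-term relation of the Bernoulli functions. -/
lemma bernBar_three_term (x y : ℝ) :
    (bernBar2 x + bernBar2 y + bernBar2 (x + y)) / 2 + bernBar1 x * bernBar1 y
      - bernBar1 (x + y) * (bernBar1 x + bernBar1 y) = indZ x * indZ y / 4 := by
  have hx0 := Int.fract_nonneg x
  have hx1 := Int.fract_lt_one x
  have hy0 := Int.fract_nonneg y
  have hy1 := Int.fract_lt_one y
  simp only [bernBar1_eq, bernBar2, indZ_eq]
  have hxy : Int.fract (x + y) = Int.fract (Int.fract x + Int.fract y) := by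
    rw [Int.fract_eq_fract]
    exact ⟨⌊x⌋ + ⌊y⌋, by push_cast; rw [Int.fract, Int.fract]; ring⟩
  rw [hxy]
  set u := Int.fract x
  set v := Int.fract y
  -- The fractional part of `u + v` is `u + v` or `u + v - 1`, and each case is a polynomial
  -- identity. The corrections of `bernBar1` at integers leave a defect only for `u = v = 0`, where
  -- three values `1/6`, halved, give `1/4`.
  rcases lt_or_ge (u + v) 1 with h | h
  · have e : Int.fract (u + v) = u + v := Int.fract_eq_self.mpr ⟨by linarith, h⟩
    rw [e]
    by_cases hu : u = 0 <;> by_cases hv : v = 0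
    · simp [hu, hv]; norm_num
    · simp only [hu, hv, zero_add, if_true, if_false]; ring
    · simp only [hu, hv, add_zero, if_true, if_false]; ring
    · have huv : u + v ≠ 0 := fun h0 => hu (by linarith)
      simp only [hu, hv, huv, if_false]; ring
  · have e : Int.fract (u + v) = u + v - 1 := by
      rw [← Int.fract_sub_one]
      exact Int.fract_eq_self.mpr ⟨by linarith, by linarith⟩
    have hu : u ≠ 0 := fun h0 => by linarith
    have hv : v ≠ 0 := fun h0 => by linarith
    rw [e]
    by_cases huv : u + v - 1 = 0
    · have hv' : v = 1 - u := by linarith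
      simp only [hu, hv, huv, if_true, if_false]
      rw [hv']; ring
    · simp only [hu, hv, huv, if_false]; ring

end Bernoulli

/-! ### The core distribution and the fibres of upper triangular matrices. -/

section Distribution

/-- A `1`-periodic real function as a function on `ℚ/ℤ`. -/
noncomputable def onQZ (f : ℝ → ℝ) (hf : Function.Periodic f 1) : AddCircle (1 : ℚ) → ℝ :=
  Function.Periodic.lift (f := fun q : ℚ => f q) (c := 1) fun q => by
    push_cast
    exact hf q

lemma IrrVec.ne_zero (ω : IrrVec) (i : Fin 2) : ω.1 i ≠ 0 := ω.2.ne_zero i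

lemma IrrVec.div_ne_zero (ω : IrrVec) : ω.1 1 / ω.1 0 ≠ 0 :=
  _root_.div_ne_zero (ω.ne_zero 1) (ω.ne_zero 0)

lemma real_sign_eq_div_abs {t : ℝ} (ht : t ≠ 0) : Real.sign t = t / |t| := by
  rcases lt_or_gt_of_ne ht with h | h
  · rw [Real.sign_of_neg h, abs_of_neg h, div_neg, div_self ht]
  · rw [Real.sign_of_pos h, abs_of_pos h, div_self ht]

lemma real_sign_mul (s t : ℝ) : Real.sign (s * t) = Real.sign s * Real.sign t := by
  rcases eq_or_ne s 0 with rfl | hs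
  · simp
  rcases eq_or_ne t 0 with rfl | ht
  · simp
  rw [real_sign_eq_div_abs hs, real_sign_eq_div_abs ht, real_sign_eq_div_abs (mul_ne_zero hs ht),
    abs_mul, mul_div_mul_comm]

lemma real_sign_mul_self {t : ℝ} (ht : t ≠ 0) : Real.sign t * Real.sign t = 1 := by
  rcases Real.sign_apply_eq_of_ne_zero t ht with h | h <;> simp [h]

/-- The value at `(x, ω)` of the distribution attached to the matrix with rows `(0, -1)` and
`(1, 0)`, as a function of `x` and `τ = ω₂ / ω₁`. -/
noncomputable def coreValue (x : QZ2) (τ : ℝ) : ℝ :=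
  onQZ bernBar2 bernBar2_periodic (x 0) / (2 * τ)
    + τ / 2 * onQZ bernBar2 bernBar2_periodic (x 1)
    + onQZ bernBar1 bernBar1_periodic (x 0) * onQZ bernBar1 bernBar1_periodic (x 1)
    - Real.sign τ / 4 * (onQZ indZ indZ_periodic (x 0) * onQZ indZ indZ_periodic (x 1))

/-- The `𝒜₀`-valued map `x ↦ 𝔷₀(S)(x)` for the matrix `S` with rows `(0, -1)` and `(1, 0)`. -/
noncomputable def coreMap (x : QZ2) : A0 :=
  ⟨⟨fun ω => coreValue x (ω.1 1 / ω.1 0), by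
      have h0 : Continuous fun ω : IrrVec => ω.1 0 := (continuous_apply 0).comp continuous_subtype_val
      have h1 : Continuous fun ω : IrrVec => ω.1 1 := (continuous_apply 1).comp continuous_subtype_val
      have hτ : Continuous fun ω : IrrVec => ω.1 1 / ω.1 0 := h1.div h0 fun ω => ω.ne_zero 0
      -- The sign is continuous because `τ` never vanishes on vectors with rationally independent
      -- entries.
      have hs : Continuous fun ω : IrrVec => Real.sign (ω.1 1 / ω.1 0) := by
        have : (fun ω : IrrVec => Real.sign (ω.1 1 / ω.1 0))
            = fun ω => (ω.1 1 / ω.1 0) / |ω.1 1 / ω.1 0| :=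
          funext fun ω => real_sign_eq_div_abs ω.div_ne_zero
        rw [this]
        exact hτ.div hτ.abs fun ω => abs_ne_zero.mpr ω.div_ne_zero
      unfold coreValue
      refine ((Continuous.add ?_ ?_).add continuous_const).sub ?_
      · exact continuous_const.div (continuous_const.mul hτ)
          fun ω => mul_ne_zero two_ne_zero ω.div_ne_zero
      · exact (hτ.div_const 2).mul continuous_const
      · exact (hs.div_const 4).mul continuous_const⟩, by
    intro α hα ω
    simp only [ContinuousMap.coe_mk, IrrVec.scale, Pi.smul_apply, smul_eq_mul]
    rw [mul_div_mul_left _ _ hα.ne']⟩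

lemma coreMap_apply (x : QZ2) (ω : IrrVec) : (coreMap x).1 ω = coreValue x (ω.1 1 / ω.1 0) := rfl

lemma matAct_value (γ : IntMat) (ν : QZ2 → A0) (x : QZ2) (ω : IrrVec) :
    (matAct γ ν x).1 ω = (γ.1.det.sign : ℝ) *
      ∑ y ∈ (finite_fiber γ x).toFinset, (ν y).1 (IrrVec.transposeMul γ ω) := by
  rw [matAct_apply, star_apply, zsmul_eq_mul]
  congr 1
  rw [AddSubgroup.val_finsetSum]
  rw [ContinuousMap.sum_apply]

/-- With `coe_div_injOn` and `exists_coe_div_of_zsmul_eq`, this lists the solutions of `n u = q` in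
`ℚ/ℤ` without repetition as `(q + m)/n`, `0 ≤ m < |n|`. -/
lemma zsmul_coe_div (q : ℚ) {n : ℤ} (hn : n ≠ 0) (m : ℕ) :
    n • (((q + m) / n : ℚ) : AddCircle (1 : ℚ)) = (q : AddCircle (1 : ℚ)) := by
  have hn' : (n : ℚ) ≠ 0 := by exact_mod_cast hn
  rw [← AddCircle.coe_zsmul, zsmul_eq_mul, mul_div_cancel₀ _ hn', AddCircle.coe_add]
  have : ((m : ℚ) : AddCircle (1 : ℚ)) = 0 := by
    rw [AddCircle.coe_eq_zero_iff]
    exact ⟨m, by simp⟩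
  rw [this, add_zero]

lemma coe_div_injOn (q : ℚ) {n : ℤ} (hn : n ≠ 0) :
    Set.InjOn (fun m : ℕ => (((q + m) / n : ℚ) : AddCircle (1 : ℚ))) (Finset.range n.natAbs) := by
  intro m hm m' hm' h
  have hn' : (n : ℚ) ≠ 0 := by exact_mod_cast hn
  simp only at h
  rw [← sub_eq_zero, ← AddCircle.coe_sub, AddCircle.coe_eq_zero_iff] at h
  obtain ⟨k, hk⟩ := h
  rw [zsmul_eq_mul, mul_one] at hk
  field_simp at hk
  have hk' : n * k = m - m' := by
    have : ((n * k : ℤ) : ℚ) = ((m - m' : ℤ) : ℚ) := by push_cast; linarith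
    exact_mod_cast this
  have h1 : m < n.natAbs := by simpa using hm
  have h2 : m' < n.natAbs := by simpa using hm'
  have h3 : (m : ℤ) - m' = 0 := Int.eq_zero_of_abs_lt_dvd (m := n.natAbs)
    ((Int.natAbs_dvd).mpr ⟨k, hk'.symm⟩) (by rw [abs_lt]; constructor <;> omega)
  omega

lemma exists_coe_div_of_zsmul_eq {q : ℚ} {n : ℤ} (hn : n ≠ 0) {u : AddCircle (1 : ℚ)}
    (h : n • u = (q : AddCircle (1 : ℚ))) :
    ∃ m ∈ Finset.range n.natAbs, (((q + m) / n : ℚ) : AddCircle (1 : ℚ)) = u := by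
  have hn' : (n : ℚ) ≠ 0 := by exact_mod_cast hn
  induction u using QuotientAddGroup.induction_on with
  | H r =>
    change n • ((r : ℚ) : AddCircle (1 : ℚ)) = _ at h
    rw [← AddCircle.coe_zsmul, ← sub_eq_zero, ← AddCircle.coe_sub, AddCircle.coe_eq_zero_iff] at h
    obtain ⟨k, hk⟩ := h
    rw [zsmul_eq_mul, mul_one, zsmul_eq_mul] at hk
    have hmod : (0 : ℤ) ≤ k % n := Int.emod_nonneg k hn
    obtain ⟨m, hm⟩ := Int.eq_ofNat_of_zero_le hmod
    refine ⟨m, Finset.mem_range.mpr (by have := Int.emod_lt k hn; omega), ?_⟩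
    rw [← sub_eq_zero, ← AddCircle.coe_sub, AddCircle.coe_eq_zero_iff]
    refine ⟨-(k / n), ?_⟩
    have h1 : (k : ℚ) = m + n * (k / n : ℤ) := by
      have := Int.emod_add_mul_ediv k n
      rw [hm] at this
      exact_mod_cast this.symm
    rw [zsmul_eq_mul, mul_one]
    push_cast
    field_simp
    linarith

/-- Parametrization of the fibres of `y ↦ y γᵀ` for an upper triangular matrix `γ`. -/
lemma sum_fiber_upper (γ : IntMat) (h10 : γ.1 1 0 = 0) (h00 : γ.1 0 0 ≠ 0) (h11 : γ.1 1 1 ≠ 0)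
    (x : Fin 2 → ℚ) (f : QZ2 → ℝ) :
    ∑ y ∈ (finite_fiber γ (toQZ2 x)).toFinset, f y =
      ∑ j ∈ Finset.range (γ.1 1 1).natAbs, ∑ i ∈ Finset.range (γ.1 0 0).natAbs,
        f (toQZ2 ![(x 0 - γ.1 0 1 * ((x 1 + j) / γ.1 1 1) + i) / γ.1 0 0,
          (x 1 + j) / γ.1 1 1]) := by
  rw [← Finset.sum_product']
  symm
  have hrow : ∀ y : QZ2, rowMul γ.1 y = toQZ2 x ↔
      γ.1 0 0 • y 0 + γ.1 0 1 • y 1 = (x 0 : AddCircle (1 : ℚ)) ∧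
        γ.1 1 1 • y 1 = (x 1 : AddCircle (1 : ℚ)) := by
    intro y
    rw [funext_iff, Fin.forall_fin_two]
    simp [rowMul, toQZ2, Fin.sum_univ_two, h10]
  -- Back substitution: once `y 1` is chosen, the first row is a one-variable equation for `y 0`.
  have key : ∀ (y : QZ2) (j : ℕ), y 1 = (((x 1 + j) / γ.1 1 1 : ℚ) : AddCircle (1 : ℚ)) →
      (γ.1 0 0 • y 0 + γ.1 0 1 • y 1 = (x 0 : AddCircle (1 : ℚ)) ↔ γ.1 0 0 • y 0 =
        ((x 0 - γ.1 0 1 * ((x 1 + j) / γ.1 1 1) : ℚ) : AddCircle (1 : ℚ))) := by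
    intro y j hj
    rw [hj, AddCircle.coe_sub, eq_sub_iff_add_eq, ← zsmul_eq_mul, AddCircle.coe_zsmul]
  refine Finset.sum_bij (fun p _ => toQZ2 ![(x 0 - γ.1 0 1 * ((x 1 + p.1) / γ.1 1 1) + p.2) /
    γ.1 0 0, (x 1 + p.1) / γ.1 1 1]) ?_ ?_ ?_ (fun _ _ => rfl)
  · rintro ⟨j, i⟩ -
    rw [Set.Finite.mem_toFinset]
    refine (hrow _).mpr ⟨(key _ j ?_).mpr ?_, ?_⟩
    · simp [toQZ2]
    · exact zsmul_coe_div _ h00 i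
    · exact zsmul_coe_div _ h11 j
  · rintro ⟨j, i⟩ hp ⟨j', i'⟩ hp' h
    rw [Finset.mem_product] at hp hp'
    have e1 := congrFun h 1
    have hj : j = j' := coe_div_injOn _ h11 hp.1 hp'.1 (by simpa [toQZ2] using e1)
    subst hj
    have e0 := congrFun h 0
    have hi : i = i' := coe_div_injOn _ h00 hp.2 hp'.2 (by simpa [toQZ2] using e0)
    rw [hi]
  · intro y hy
    rw [Set.Finite.mem_toFinset] at hy
    obtain ⟨h0, h1⟩ := (hrow y).mp hy
    obtain ⟨j, hj, hj'⟩ := exists_coe_div_of_zsmul_eq h11 h1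
    obtain ⟨i, hi, hi'⟩ := exists_coe_div_of_zsmul_eq h00 ((key y j hj'.symm).mp h0)
    refine ⟨(j, i), Finset.mem_product.mpr ⟨hj, hi⟩, ?_⟩
    funext k
    fin_cases k
    · simpa [toQZ2] using hi'
    · simpa [toQZ2] using hj'

end Distribution

/-! ### The upper triangular action on the core distribution. -/

section Core

/-- The expression `zExplicit` in terms of the first column `(a, c)` and of `τ`, for `c ≠ 0`. -/
noncomputable def columnValue (a c : ℤ) (x : Fin 2 → ℚ) (τ : ℝ) : ℝ :=
  (Int.gcd a c : ℝ) ^ 2 / (2 * c * (a + c * τ)) *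
      bernBar2 (c / (Int.gcd a c : ℝ) * x 0 - a / (Int.gcd a c : ℝ) * x 1)
    + (a + c * τ) / (2 * c) * bernBar2 (x 1)
    + Real.sign c * dedekindRademacher (-a) c (fun i => (x i : ℝ))
    - Real.sign (c * (a + c * τ)) / 4 * indZ (x 0) * indZ (x 1)

lemma zExplicit_of_ne_zero {γ : IntMat} (hc : γ.1 1 0 ≠ 0) (x : Fin 2 → ℚ) (ω : IrrVec) :
    zExplicit γ x ω = columnValue (γ.1 0 0) (γ.1 1 0) x (ω.1 1 / ω.1 0) := by
  rw [zExplicit]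
  simp only [if_neg hc, columnValue]

lemma zExplicit_of_eq_zero {γ : IntMat} (hc : γ.1 1 0 = 0) (x : Fin 2 → ℚ) (ω : IrrVec) :
    zExplicit γ x ω = 0 := by
  rw [zExplicit]
  simp only [if_pos hc]

lemma coreValue_toQZ2 (q r : ℚ) (τ : ℝ) : coreValue (toQZ2 ![q, r]) τ =
    bernBar2 q / (2 * τ) + τ / 2 * bernBar2 r + bernBar1 q * bernBar1 r
      - Real.sign τ / 4 * (indZ q * indZ r) := rfl

lemma IrrVec.add_mul_ne_zero (ω : IrrVec) (a : ℤ) {c : ℤ} (hc : c ≠ 0) :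
    (a : ℝ) + c * (ω.1 1 / ω.1 0) ≠ 0 := by
  intro h
  have h0 := ω.ne_zero 0
  field_simp at h
  have := Fintype.linearIndependent_iff.mp ω.2 ![(a : ℚ), c] (by
    simp only [Fin.sum_univ_two, Matrix.cons_val_zero, Matrix.cons_val_one,
      Rat.smul_def]
    push_cast
    linarith) 1
  simp at this
  exact hc this

lemma sum_coreValue_left {p : ℤ} (hp : p ≠ 0) (q r : ℚ) (τ : ℝ) :
    ∑ i ∈ Finset.range p.natAbs, coreValue (toQZ2 ![(q + i) / p, r]) τ =
      bernBar2 q / p.natAbs / (2 * τ) + p.natAbs * (τ / 2 * bernBar2 r)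
        + Real.sign p * bernBar1 q * bernBar1 r - Real.sign τ / 4 * (indZ q * indZ r) := by
  simp only [coreValue_toQZ2]
  push_cast
  rw [Finset.sum_sub_distrib, Finset.sum_add_distrib, Finset.sum_add_distrib, ← Finset.sum_div,
    sum_bernBar2 _ hp, Finset.sum_const, Finset.card_range, nsmul_eq_mul, ← Finset.sum_mul,
    sum_bernBar1 _ hp, ← Finset.mul_sum, ← Finset.sum_mul, sum_indZ _ hp]

/-- Either `y` is not an integer and both sides vanish, or `a y` is a period of `indZ`. -/
lemma indZ_sub_mul_mul_indZ (x y : ℝ) (a : ℤ) :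
    indZ (x - a * y) * indZ y = indZ x * indZ y := by
  by_cases hy : Int.fract y = 0
  · obtain ⟨n, hn⟩ := mem_intSet_iff.mpr hy
    have := indZ_periodic.sub_int_mul_eq (a * n) (x := x)
    rw [← hn, ← this]
    push_cast
    rw [mul_one]
  · have : indZ y = 0 := by rw [indZ_eq, if_neg hy]
    simp [this]

/-- The action of an upper triangular matrix on the distribution `coreMap`. -/
theorem matAct_upper_value (γ : IntMat) (h10 : γ.1 1 0 = 0) (x : Fin 2 → ℚ) (ω : IrrVec) :
    (matAct γ coreMap (toQZ2 x)).1 ω = columnValue (γ.1 0 1) (γ.1 1 1) x (ω.1 1 / ω.1 0) := by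
  have hdet : γ.1.det = γ.1 0 0 * γ.1 1 1 := by rw [Matrix.det_fin_two, h10, mul_zero, sub_zero]
  have hne := IntMat.det_ne_zero γ
  rw [hdet] at hne
  have h00 := left_ne_zero_of_mul hne
  have h11 := right_ne_zero_of_mul hne
  have hω0 := ω.ne_zero 0
  have hτ : (IrrVec.transposeMul γ ω).1 1 / (IrrVec.transposeMul γ ω).1 0
      = (γ.1 0 1 + γ.1 1 1 * (ω.1 1 / ω.1 0)) / γ.1 0 0 := by
    have h00' : (γ.1 0 0 : ℝ) ≠ 0 := by exact_mod_cast h00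
    simp only [IrrVec.transposeMul, Matrix.mulVec, dotProduct, Fin.sum_univ_two,
      Matrix.transpose_apply, Matrix.map_apply, h10]
    push_cast
    rw [zero_mul, add_zero]
    field_simp
  rw [matAct_value, sum_fiber_upper γ h10 h00 h11]
  simp only [coreMap_apply, hτ]
  have hσ0 := ω.add_mul_ne_zero (γ.1 0 1) h11
  rw [hdet]
  generalize γ.1 0 0 = p at *
  generalize γ.1 0 1 = a at *
  generalize γ.1 1 1 = c at *
  set σ : ℝ := a + c * (ω.1 1 / ω.1 0) with hσ
  have hpr : (p : ℝ) ≠ 0 := by exact_mod_cast h00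
  have hcr : (c : ℝ) ≠ 0 := by exact_mod_cast h11
  simp only [sum_coreValue_left h00]
  push_cast
  rw [Finset.sum_sub_distrib, Finset.sum_add_distrib, Finset.sum_add_distrib, ← Finset.sum_div,
    ← Finset.sum_div, ← Finset.mul_sum, ← Finset.mul_sum, sum_bernBar2 _ h11, ← Finset.mul_sum]
  simp only [indZ_sub_mul_mul_indZ]
  rw [← Finset.mul_sum, sum_indZ _ h11]
  -- The inner sum over `i` has been evaluated. In the outer sum this term yields the gcd, and the
  -- product of two `bernBar1` yields the Dedekind–Rademacher sum.
  have e1 : ∑ j ∈ Finset.range c.natAbs, bernBar2 ((x 0 : ℝ) - a * ((x 1 + j) / c)) =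
      (Int.gcd a c : ℝ) ^ 2 / c.natAbs *
        bernBar2 (c / (Int.gcd a c : ℝ) * x 0 - a / (Int.gcd a c : ℝ) * x 1) := by
    rw [← sum_bernBar2_lattice a h11]
    refine Finset.sum_congr rfl fun j _ => ?_
    congr 1
    push_cast
    ring
  have e2 : ∑ j ∈ Finset.range c.natAbs, Real.sign p * bernBar1 ((x 0 : ℝ) - a * ((x 1 + j) / c)) *
      bernBar1 ((x 1 + j) / c) = Real.sign p * dedekindRademacher (-a) c (fun i => (x i : ℝ)) := by
    rw [dedekindRademacher, Finset.mul_sum]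
    refine Finset.sum_congr rfl fun j _ => ?_
    rw [mul_assoc]
    congr 3
    · push_cast
      ring
    · ring
  have e3 : Real.sign (σ / p) = Real.sign σ * Real.sign p := by
    have : σ / p = σ * p * ((p : ℝ)⁻¹ * (p : ℝ)⁻¹) := by field_simp
    rw [this, real_sign_mul, real_sign_mul, Real.sign_of_pos (mul_self_pos.mpr (inv_ne_zero hpr)),
      mul_one]
  have habs : ∀ n : ℤ, n ≠ 0 → ((n.natAbs : ℕ) : ℝ) = Real.sign n * n := by
    intro n hn
    obtain ⟨-, ⟨h, h'⟩ | ⟨h, h'⟩⟩ := natAbs_cases hn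
    · rw [h', ← h, one_mul]
    · rw [h', h]; ring
  have hsp := real_sign_mul_self hpr
  have hsc := real_sign_mul_self hcr
  have hinv : ∀ s : ℝ, s * s = 1 → s⁻¹ = s := fun s hs => inv_eq_of_mul_eq_one_left hs
  rw [e1, e2, e3, columnValue, habs p h00, habs c h11, ← hσ, real_sign_mul (c : ℝ) σ,
    Int.sign_mul]
  clear_value σ
  push_cast
  rw [← Real.sign_intCast, ← Real.sign_intCast]
  generalize Real.sign (p : ℝ) = sp at *
  generalize Real.sign (c : ℝ) = sc at *
  simp only [div_eq_mul_inv, mul_inv, inv_inv, hinv sp hsp, hinv sc hsc]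
  have hpi : (p : ℝ) * (p : ℝ)⁻¹ = 1 := mul_inv_cancel₀ hpr
  generalize dedekindRademacher _ _ _ = S
  generalize bernBar2 (_ - _) = B
  generalize bernBar2 _ = B'
  generalize indZ (x 0 : ℝ) = D
  generalize indZ (x 1 : ℝ) = D'
  generalize (Int.gcd a c : ℝ) = g
  generalize (p : ℝ)⁻¹ = pi at *
  generalize (p : ℝ) = P at *
  generalize Real.sign σ = sσ
  generalize (c : ℝ)⁻¹ = ci
  -- The sign of the determinant is `sp * sc`, so the top left entry occurs only in `sp * sp` and `P
  -- * pi`, both equal to `1`.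
  trans (sp * sp) * (sc * sc) * (P * pi) * (g ^ 2 * ci * B * 2⁻¹ * σ⁻¹ + σ * 2⁻¹ * B' * ci)
    + (sp * sp) * (sc * S - sc * sσ * 4⁻¹ * (D * D'))
  · ring
  · rw [hsp, hsc, hpi]
    ring

end Core

/-! ### Relations satisfied by the core distribution. -/

section Action

lemma toQZ2_surjective : Function.Surjective toQZ2 := by
  intro y
  have h : ∀ i, ∃ q : ℚ, (q : AddCircle (1 : ℚ)) = y i := fun i => QuotientAddGroup.mk_surjective (y i)
  choose q hq using h
  exact ⟨q, funext hq⟩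

lemma ext_value {ν ν' : QZ2 → A0}
    (h : ∀ (x : Fin 2 → ℚ) (ω : IrrVec), (ν (toQZ2 x)).1 ω = (ν' (toQZ2 x)).1 ω) : ν = ν' := by
  funext y
  obtain ⟨x, rfl⟩ := toQZ2_surjective y
  exact Subtype.ext (ContinuousMap.ext (h x))

/-- For `a = 0` the Dedekind–Rademacher sum collapses by the distribution relation of `bernBar1`,
and `c` cancels everywhere. -/
lemma columnValue_zero {c : ℤ} (hc : c ≠ 0) (x : Fin 2 → ℚ) {τ : ℝ} (hτ : τ ≠ 0) :
    columnValue 0 c x τ = coreValue (toQZ2 x) τ := by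
  have hcr : (c : ℝ) ≠ 0 := by exact_mod_cast hc
  have hx : x = ![x 0, x 1] := by
    funext i
    fin_cases i <;> rfl
  have hS : dedekindRademacher (-0) c (fun i => (x i : ℝ))
      = bernBar1 (x 0) * (Real.sign c * bernBar1 (x 1)) := by
    rw [← sum_bernBar1 _ hc, Finset.mul_sum, dedekindRademacher]
    refine Finset.sum_congr rfl fun j _ => ?_
    rw [mul_one_div]
    simp
  have hB : bernBar2 (c / (Int.gcd 0 c : ℝ) * x 0 - (0 : ℤ) / (Int.gcd 0 c : ℝ) * x 1)
      = bernBar2 (x 0) := by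
    rw [Int.gcd_zero_left]
    obtain ⟨hk, ⟨h, -⟩ | ⟨h, -⟩⟩ := natAbs_cases hc
    · have hk' : (c.natAbs : ℝ) ≠ 0 := by exact_mod_cast hk.ne'
      rw [h, div_self hk']
      simp
    · have hk' : (c.natAbs : ℝ) ≠ 0 := by exact_mod_cast hk.ne'
      rw [h, neg_div, div_self hk']
      simp [bernBar2_neg]
  have hg : (Int.gcd 0 c : ℝ) ^ 2 = (c : ℝ) ^ 2 := by
    rw [Int.gcd_zero_left, Nat.cast_natAbs, Int.cast_abs, sq_abs]
  have hs : Real.sign (c * ((0 : ℤ) + c * τ)) = Real.sign τ := by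
    rw [Int.cast_zero, zero_add, real_sign_mul, real_sign_mul, ← mul_assoc, real_sign_mul_self hcr,
      one_mul]
  rw [columnValue, hS, hB, hg, hs, hx, coreValue_toQZ2]
  have hsc := real_sign_mul_self hcr
  simp only [Matrix.cons_val_zero, Matrix.cons_val_one, Int.cast_zero, zero_add]
  have e1 : (c : ℝ) ^ 2 / (2 * c * (c * τ)) = 1 / (2 * τ) := by field_simp
  have e2 : (c : ℝ) * τ / (2 * c) = τ / 2 := by field_simp
  rw [e1, e2]
  linear_combination bernBar1 (x 0) * bernBar1 (x 1) * hsc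

/-- For positive scalars this is the distribution relation, for `-I₂` the invariance defining `𝒟₀`.
-/
lemma matAct_diag (γ : IntMat) (h10 : γ.1 1 0 = 0) (h01 : γ.1 0 1 = 0) :
    matAct γ coreMap = coreMap := by
  refine ext_value fun x ω => ?_
  have h11 : γ.1 1 1 ≠ 0 := by
    intro h
    apply IntMat.det_ne_zero γ
    rw [Matrix.det_fin_two, h10, h]
    ring
  rw [matAct_upper_value γ h10, h01, columnValue_zero h11 x ω.div_ne_zero, coreMap_apply]

/-- The cocycle value at the matrix with rows `(0, -1)` and `(1, 0)`. -/
noncomputable def core : calD0 :=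
  ⟨⟨coreMap, (mem_D0_iff _).mpr fun c hc => matAct_diag _ (by simp [scalarMat]) (by simp [scalarMat])⟩,
    by
      change glAct (-1) _ = _
      rw [glAct_eq (-1) 1 (scalarMat (-1) (by norm_num)) one_pos (by
        ext i j
        fin_cases i <;> fin_cases j <;> simp [scalarMat])]
      exact Subtype.ext (matAct_diag _ (by simp [scalarMat]) (by simp [scalarMat]))⟩

lemma pglRep_toPGL_val (γ : IntMat) (v : calD0) :
    (pglRep (toPGL γ) v).1.1 = matAct γ v.1.1 := by
  have : (pglRep (toPGL γ) v).1 = distAct γ v.1 := by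
    change glAct _ v.1 = _
    refine glAct_eq _ 1 γ one_pos ?_ v.1
    rw [Nat.cast_one, one_smul]
    rfl
  rw [this]
  rfl

lemma calD0_ext {v w : calD0} (h : v.1.1 = w.1.1) : v = w := Subtype.ext (Subtype.ext h)

lemma toPGL_mul (γ δ : IntMat) : toPGL (γ * δ) = toPGL γ * toPGL δ := by
  rw [toPGL, toPGL, toPGL, ← map_mul]
  congr 1
  refine Units.ext ?_
  exact map_mul (Int.castRingHom ℚ).mapMatrix γ.1 δ.1

lemma pglRep_toPGL_mul (γ δ : IntMat) (v : calD0) :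
    pglRep (toPGL (γ * δ)) v = pglRep (toPGL γ) (pglRep (toPGL δ) v) := by
  rw [toPGL_mul, map_mul]
  rfl

lemma mul_scalar_apply (g : GL (Fin 2) ℚ) (u : ℚˣ) (i j : Fin 2) :
    (g * Matrix.GeneralLinearGroup.scalar (Fin 2) u).1 i j = g.1 i j * u.1 := by
  rw [Units.val_mul, Matrix.GeneralLinearGroup.coe_scalar, Matrix.scalar_apply,
    Matrix.mul_diagonal]

lemma toPGL_eq_iff {γ δ : IntMat} : toPGL γ = toPGL δ ↔
    ∃ m n : ℤ, m ≠ 0 ∧ n ≠ 0 ∧ ∀ i j, m * γ.1 i j = n * δ.1 i j := by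
  rw [toPGL, toPGL, Matrix.ProjGenLinGroup.mk_eq_mk_iff]
  constructor
  · rintro ⟨u, hu⟩
    refine ⟨u.1.num, u.1.den, Rat.num_ne_zero.mpr u.ne_zero, by exact_mod_cast u.1.den_nz,
      fun i j => ?_⟩
    have h' : (γ.1 i j : ℚ) * u.1 = δ.1 i j := by
      have h := mul_scalar_apply
        (Matrix.GeneralLinearGroup.mkOfDetNeZero _ (det_map_ne_zero γ)) u i j
      rw [hu] at h
      exact h.symm
    have : ((u.1.num * γ.1 i j : ℤ) : ℚ) = ((u.1.den * δ.1 i j : ℤ) : ℚ) := by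
      push_cast
      rw [← h', ← Rat.den_mul_eq_num]
      ring
    exact_mod_cast this
  · rintro ⟨m, n, hm, hn, h⟩
    have hm' : (m : ℚ) ≠ 0 := by exact_mod_cast hm
    have hn' : (n : ℚ) ≠ 0 := by exact_mod_cast hn
    refine ⟨Units.mk0 (m / n : ℚ) (div_ne_zero hm' hn'), Units.ext ?_⟩
    ext i j
    have h2 : (m : ℚ) * γ.1 i j = n * δ.1 i j := by exact_mod_cast h i j
    have h3 : (γ.1 i j : ℚ) * (m / n) = δ.1 i j := by
      field_simp
      linarith
    rw [mul_scalar_apply]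
    exact h3

lemma toPGL_surjective : Function.Surjective toPGL := by
  intro g
  induction g using Matrix.ProjGenLinGroup.induction_on with
  | mk g =>
    obtain ⟨⟨c, γ⟩, hc, hγ⟩ := exists_clear g
    refine ⟨γ, ?_⟩
    have hc' : (c : ℚ) ≠ 0 := by exact_mod_cast hc.ne'
    rw [toPGL, eq_comm, Matrix.ProjGenLinGroup.mk_eq_mk_iff]
    refine ⟨Units.mk0 (c : ℚ) hc', Units.ext ?_⟩
    ext i j
    have := congrFun (congrFun hγ i) j
    simp only [Matrix.map_apply, Matrix.smul_apply, smul_eq_mul] at this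
    rw [mul_scalar_apply, mul_comm]
    exact this.symm

/-- An invertible integral matrix permutes `ℚ²/ℤ²`, so each fibre is a single point. -/
lemma matAct_unimodular_value (γ : IntMat) (hdet : γ.1.det = 1) (δ : Matrix (Fin 2) (Fin 2) ℤ)
    (hδ : δ * γ.1 = 1) (ν : QZ2 → A0) (x : QZ2) (ω : IrrVec) :
    (matAct γ ν x).1 ω = (ν (rowMul δ x)).1 (IrrVec.transposeMul γ ω) := by
  have h1 : ∀ y, rowMul 1 y = y := fun y => by
    rw [← one_smul ℤ (1 : Matrix (Fin 2) (Fin 2) ℤ), smul_one_eq, rowMul_scalar, one_smul]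
  have hfib : (finite_fiber γ x).toFinset = {rowMul δ x} := by
    ext y
    rw [Set.Finite.mem_toFinset, Finset.mem_singleton, Set.mem_ofPred_eq]
    constructor
    · rintro rfl
      rw [← rowMul_mul, hδ, h1]
    · rintro rfl
      rw [← rowMul_mul, mul_eq_one_comm.mp hδ, h1]
  rw [matAct_value, hfib, Finset.sum_singleton, hdet]
  simp

/-- The matrix with rows `(1, -1)` and `(0, 1)`. -/
def matTInv : IntMat := ⟨!![1, -1; 0, 1], by simp [IntMat]⟩

/-- The matrix with rows `(0, -1)` and `(1, 1)`. -/
def matST : IntMat := ⟨!![0, -1; 1, 1], by simp [IntMat]⟩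

/-- The substitution is `x ↦ (x₂, -x₁)`, `τ ↦ -1/τ`: it exchanges the two `bernBar2` terms and
changes the sign of every term. -/
lemma pglRep_matS_core : pglRep (toPGL matS) core = -core := by
  refine calD0_ext ?_
  rw [pglRep_toPGL_val]
  refine ext_value fun x ω => ?_
  change (matAct matS coreMap (toQZ2 x)).1 ω = -(coreMap (toQZ2 x)).1 ω
  rw [matAct_unimodular_value matS (by simp [matS]) !![0, 1; -1, 0] (by
    ext i j; fin_cases i <;> fin_cases j <;> simp [matS])]
  have hx : x = ![x 0, x 1] := by
    funext i
    fin_cases i <;> rfl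
  have hr : rowMul !![0, 1; -1, 0] (toQZ2 x) = toQZ2 ![x 1, -x 0] := by
    funext i
    fin_cases i <;> simp [rowMul, toQZ2]
  have h0 := ω.ne_zero 0
  have h1 := ω.ne_zero 1
  have hτ : (IrrVec.transposeMul matS ω).1 1 / (IrrVec.transposeMul matS ω).1 0
      = -(ω.1 1 / ω.1 0)⁻¹ := by
    simp [IrrVec.transposeMul, matS]
    ring
  rw [coreMap_apply, coreMap_apply, hr, hτ, hx, coreValue_toQZ2, coreValue_toQZ2]
  have hτ0 := ω.div_ne_zero
  generalize ω.1 1 / ω.1 0 = τ at *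
  have hs : Real.sign (-τ⁻¹) = -Real.sign τ := by
    rw [← Real.inv_sign τ, real_sign_eq_div_abs (neg_ne_zero.mpr (inv_ne_zero hτ0)),
      real_sign_eq_div_abs hτ0, abs_neg, abs_inv]
    field_simp
  simp only [Matrix.cons_val_zero, Matrix.cons_val_one]
  push_cast
  rw [hs, bernBar2_neg, bernBar1_neg, indZ_neg]
  field_simp
  ring

/-- The constant `1` is what cancels the defect on the right of `bernBar_three_term`. -/
lemma sign_three_term {τ : ℝ} (h0 : τ ≠ 0) (h1 : τ - 1 ≠ 0) :
    Real.sign τ + Real.sign ((τ - 1) / τ) - Real.sign (τ - 1) = 1 := by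
  rcases lt_or_gt_of_ne h0 with h | h
  · rw [Real.sign_of_neg h, Real.sign_of_pos (div_pos_of_neg_of_neg (by linarith) h),
      Real.sign_of_neg (by linarith)]
    norm_num
  · rcases lt_or_gt_of_ne h1 with h' | h'
    · rw [Real.sign_of_pos h, Real.sign_of_neg (div_neg_of_neg_of_pos h' h), Real.sign_of_neg h']
      norm_num
    · rw [Real.sign_of_pos h, Real.sign_of_pos (div_pos h' h), Real.sign_of_pos h']
      norm_num

/-- All three terms involve only `x₁`, `x₂`, `x₁ + x₂`. Partial fractions in `τ` cancel the terms
depending rationally on `τ`, leaving `bernBar_three_term` and `sign_three_term`. -/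
lemma pglRep_matTInv_core :
    pglRep (toPGL matTInv) core = pglRep (toPGL matST) core + core := by
  refine calD0_ext ?_
  change _ = (pglRep (toPGL matST) core).1.1 + coreMap
  rw [pglRep_toPGL_val, pglRep_toPGL_val]
  refine ext_value fun x ω => ?_
  change (matAct matTInv coreMap (toQZ2 x)).1 ω
    = (matAct matST coreMap (toQZ2 x)).1 ω + (coreMap (toQZ2 x)).1 ω
  rw [matAct_unimodular_value matTInv (by simp [matTInv]) !![1, 1; 0, 1] (by
      ext i j; fin_cases i <;> fin_cases j <;> simp [matTInv]),
    matAct_unimodular_value matST (by simp [matST]) !![1, 1; -1, 0] (by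
      ext i j; fin_cases i <;> fin_cases j <;> simp [matST])]
  have hx : x = ![x 0, x 1] := by
    funext i
    fin_cases i <;> rfl
  have hr1 : rowMul !![1, 1; 0, 1] (toQZ2 x) = toQZ2 ![x 0 + x 1, x 1] := by
    funext i
    fin_cases i <;> simp [rowMul, toQZ2]
  have hr2 : rowMul !![1, 1; -1, 0] (toQZ2 x) = toQZ2 ![x 0 + x 1, -x 0] := by
    funext i
    fin_cases i <;> simp [rowMul, toQZ2]
  have h0 := ω.ne_zero 0
  have h1 := ω.ne_zero 1
  have hτ1 : (IrrVec.transposeMul matTInv ω).1 1 / (IrrVec.transposeMul matTInv ω).1 0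
      = ω.1 1 / ω.1 0 - 1 := by
    simp [IrrVec.transposeMul, matTInv]
    field_simp
    ring
  have hτ2 : (IrrVec.transposeMul matST ω).1 1 / (IrrVec.transposeMul matST ω).1 0
      = (ω.1 1 / ω.1 0 - 1) / (ω.1 1 / ω.1 0) := by
    simp [IrrVec.transposeMul, matST]
    field_simp
    ring
  have hτ0 := ω.div_ne_zero
  have hτ3 : ω.1 1 / ω.1 0 - 1 ≠ 0 := by
    have := ω.add_mul_ne_zero (-1) (c := 1) one_ne_zero
    intro h
    apply this
    push_cast
    linarith
  rw [coreMap_apply, coreMap_apply, coreMap_apply, hr1, hr2, hτ1, hτ2, hx, coreValue_toQZ2,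
    coreValue_toQZ2, coreValue_toQZ2]
  generalize ω.1 1 / ω.1 0 = τ at *
  simp only [Matrix.cons_val_zero, Matrix.cons_val_one]
  push_cast
  rw [bernBar2_neg, bernBar1_neg, indZ_neg]
  have hT := bernBar_three_term (x 0) (x 1)
  have hs := sign_three_term hτ0 hτ3
  -- If two of `x₁`, `x₂`, `x₁ + x₂` are integers, so is the third; the sign terms thus share one
  -- indicator.
  have hd1 : indZ ((x 0 : ℝ) + x 1) * indZ (x 1) = indZ (x 0) * indZ (x 1) := by
    have := indZ_sub_mul_mul_indZ ((x 0 : ℝ) + x 1) (x 1) 1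
    rw [Int.cast_one, one_mul, add_sub_cancel_right] at this
    exact this.symm
  have hd2 : indZ ((x 0 : ℝ) + x 1) * indZ (x 0) = indZ (x 0) * indZ (x 1) := by
    have := indZ_sub_mul_mul_indZ ((x 0 : ℝ) + x 1) (x 0) 1
    rw [Int.cast_one, one_mul, add_sub_cancel_left] at this
    rw [← this, mul_comm]
  rw [hd1, hd2]
  generalize bernBar2 ((x 0 : ℝ) + x 1) = B at hT ⊢
  have e1 : B / (2 * (τ - 1)) = B / (2 * ((τ - 1) / τ)) - B / 2 := by
    field_simp
    ring
  have e2 : (τ - 1) / τ / 2 * bernBar2 (x 0) = bernBar2 (x 0) / 2 - bernBar2 (x 0) / (2 * τ) := by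
    field_simp
  rw [e1, e2]
  linear_combination (-1 : ℝ) * hT + indZ (x 0) * indZ (x 1) / 4 * hs

end Action

/-! ### Construction of the cocycle and the cocycle law. -/

section Cocycle

/-- The matrix with rows `(a, b)` and `(c, d)`. -/
def ofEntries (a b c d : ℤ) (h : a * d - b * c ≠ 0) : IntMat :=
  ⟨!![a, b; c, d], by simpa [IntMat, Matrix.det_fin_two] using h⟩

/-- The top left entry does not occur in `columnValue`. -/
lemma pglRep_upper_core {γ δ : IntMat} (hγ : γ.1 1 0 = 0) (hδ : δ.1 1 0 = 0)
    (h0 : γ.1 0 1 = δ.1 0 1) (h1 : γ.1 1 1 = δ.1 1 1) :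
    pglRep (toPGL γ) core = pglRep (toPGL δ) core := by
  refine calD0_ext ?_
  rw [pglRep_toPGL_val, pglRep_toPGL_val]
  refine ext_value fun x ω => ?_
  change (matAct γ coreMap _).1 ω = (matAct δ coreMap _).1 ω
  rw [matAct_upper_value γ hγ, matAct_upper_value δ hδ, h0, h1]

lemma pglRep_diag_core {γ : IntMat} (h10 : γ.1 1 0 = 0) (h01 : γ.1 0 1 = 0) :
    pglRep (toPGL γ) core = core := by
  refine calD0_ext ?_
  rw [pglRep_toPGL_val]
  exact matAct_diag γ h10 h01

lemma pglRep_add (g : Matrix.ProjGenLinGroup (Fin 2) ℚ) (v w : calD0) :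
    pglRep g (v + w) = pglRep g v + pglRep g w :=
  map_add (pglRep g) v w

lemma pglRep_of_eq_zero (g : Matrix.ProjGenLinGroup (Fin 2) ℚ) {v : calD0} (h : v = 0) :
    pglRep g v = 0 := by
  subst h
  exact map_zero (pglRep g)

lemma pglRep_add_of_eq_zero (g : Matrix.ProjGenLinGroup (Fin 2) ℚ) {v : calD0} (h : v = 0)
    (w : calD0) : pglRep g v + w = w := by
  rw [pglRep_of_eq_zero g h]
  exact zero_add w

lemma pglRep_add_eq_zero (g : Matrix.ProjGenLinGroup (Fin 2) ℚ) {v w : calD0} (h : v = -w) :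
    pglRep g v + pglRep g w = 0 := by
  have hvw : v + w = 0 := by
    rw [h]
    exact neg_add_cancel w
  exact (pglRep_add g v w).symm.trans (pglRep_of_eq_zero g hvw)

/-- The cocycle value at a matrix with first column `(a, c)`. -/
noncomputable def columnCocycle (a c : ℤ) : calD0 :=
  if hc : c = 0 then 0 else pglRep (toPGL (matUpper a c hc)) core

lemma columnCocycle_zero (a : ℤ) : columnCocycle a 0 = 0 := dif_pos rfl

lemma columnCocycle_of_ne (a : ℤ) {c : ℤ} (hc : c ≠ 0) :
    columnCocycle a c = pglRep (toPGL (matUpper a c hc)) core := dif_neg hc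

lemma columnCocycle_of_upper {γ : IntMat} (h10 : γ.1 1 0 = 0) :
    columnCocycle (γ.1 0 1) (γ.1 1 1) = pglRep (toPGL γ) core := by
  have h11 : γ.1 1 1 ≠ 0 := by
    intro h
    apply IntMat.det_ne_zero γ
    rw [Matrix.det_fin_two, h10, h]
    ring
  exact (columnCocycle_of_ne _ h11).trans (pglRep_upper_core rfl h10 rfl rfl)

/-- The value depends only on the point `(a : c)` of the projective line, as is needed to descend to
`PGL₂(ℚ)`. -/
lemma columnCocycle_mul (a c : ℤ) {m : ℤ} (hm : m ≠ 0) :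
    columnCocycle (m * a) (m * c) = columnCocycle a c := by
  rcases eq_or_ne c 0 with rfl | hc
  · simp [columnCocycle]
  · have hd : m * (m * c) - m * a * 0 ≠ 0 := by
      simp [hm, hc]
    have h1 : toPGL (ofEntries m (m * a) 0 (m * c) hd) = toPGL (matUpper a c hc) := by
      refine toPGL_eq_iff.mpr ⟨1, m, one_ne_zero, hm, fun i j => ?_⟩
      fin_cases i <;> fin_cases j <;> simp [ofEntries, matUpper]
    have h2 := columnCocycle_of_upper (γ := ofEntries m (m * a) 0 (m * c) hd) rfl
    rw [h1] at h2
    exact h2.trans (columnCocycle_of_ne a hc).symm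

lemma pglRep_eq_of_mul {γ δ ε : IntMat} (h : toPGL γ = toPGL (δ * ε)) (v : calD0) :
    pglRep (toPGL γ) v = pglRep (toPGL δ) (pglRep (toPGL ε) v) :=
  (congrArg (fun g => pglRep g v) h).trans (pglRep_toPGL_mul δ ε v)

lemma pglRep_eq_of_mul_mul {γ δ ε ζ : IntMat} (h : toPGL γ = toPGL (δ * (ε * ζ)))
    (hζ : ζ.1 1 0 = 0) (hζ' : ζ.1 0 1 = 0) :
    pglRep (toPGL γ) core = pglRep (toPGL δ) (pglRep (toPGL ε) core) :=
  (pglRep_eq_of_mul h core).trans (congrArg _ ((pglRep_eq_of_mul rfl core).trans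
    (congrArg _ (pglRep_diag_core hζ hζ'))))

/-- The matrix is `(1, a; 0, c) · S · diag(1, -b)`, and the diagonal factor fixes `core`. -/
lemma pglRep_of_second_eq_zero {a b c : ℤ} (hc : c ≠ 0) (h : a * 0 - b * c ≠ 0) :
    pglRep (toPGL (ofEntries a b c 0 h)) core
      = pglRep (toPGL (matUpper a c hc)) (pglRep (toPGL matS) core) := by
  have hb : b ≠ 0 := by
    rintro rfl
    simp at h
  have h1 : ofEntries a b c 0 h
      = matUpper a c hc * (matS * ofEntries 1 0 0 (-b) (by simpa using hb)) := by
    apply Subtype.ext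
    change !![a, b; c, 0] = !![1, a; 0, c] * (!![0, -1; 1, 0] * !![1, 0; 0, -b])
    ext i j
    fin_cases i <;> fin_cases j <;> simp [Matrix.mul_apply, Fin.sum_univ_two]
  exact pglRep_eq_of_mul_mul (congrArg toPGL h1) rfl rfl

/-- Up to a scalar, `(1, b; 0, d)` is `(1, a; 0, c) · diag(D, d) · T⁻¹ · diag(c, D)`. Together with
`pglRep_second_entries`, which has the same two left factors, this reduces the general relation to
the one for `T⁻¹` and `ST`. -/
lemma pglRep_second_upper {a b c d D : ℤ} (hc : c ≠ 0) (hd : d ≠ 0) (hD : D = a * d - b * c)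
    (hD0 : D ≠ 0) (hn3 : D * d - 0 * 0 ≠ 0) :
    pglRep (toPGL (matUpper b d hd)) core = pglRep (toPGL (matUpper a c hc))
      (pglRep (toPGL (ofEntries D 0 0 d hn3)) (pglRep (toPGL matTInv) core)) := by
  have hn1 : c * d - (-D) * 0 ≠ 0 := by simp [hc, hd]
  have hn4 : c * D - 0 * 0 ≠ 0 := by simp [hD0, hc]
  have e1 : toPGL (matUpper b d hd)
      = toPGL (matUpper a c hc * ofEntries c (-D) 0 d hn1) := by
    refine toPGL_eq_iff.mpr ⟨c, 1, hc, one_ne_zero, fun i j => ?_⟩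
    rw [Submonoid.coe_mul, Matrix.mul_apply, Fin.sum_univ_two]
    fin_cases i <;> fin_cases j <;> simp [ofEntries, matUpper, hD] <;> ring
  have e3 : toPGL (ofEntries c (-D) 0 d hn1)
      = toPGL (ofEntries D 0 0 d hn3 * (matTInv * ofEntries c 0 0 D hn4)) := by
    refine toPGL_eq_iff.mpr ⟨D, 1, hD0, one_ne_zero, fun i j => ?_⟩
    simp only [Submonoid.coe_mul, Matrix.mul_apply, Fin.sum_univ_two]
    fin_cases i <;> fin_cases j <;> simp [ofEntries, matTInv] <;> ring
  exact (pglRep_eq_of_mul e1 core).trans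
    (congrArg _ (pglRep_eq_of_mul_mul e3 rfl rfl))

/-- Up to a scalar, `(a, b; c, d)` is `(1, a; 0, c) · diag(D, d) · ST · diag(c, d)`. -/
lemma pglRep_second_entries {a b c d D : ℤ} (hc : c ≠ 0) (hd : d ≠ 0) (hD : D = a * d - b * c)
    (hD0 : D ≠ 0) (h : a * d - b * c ≠ 0) (hn3 : D * d - 0 * 0 ≠ 0) :
    pglRep (toPGL (ofEntries a b c d h)) core = pglRep (toPGL (matUpper a c hc))
      (pglRep (toPGL (ofEntries D 0 0 d hn3)) (pglRep (toPGL matST) core)) := by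
  have hn2 : 0 * d - (-D) * c ≠ 0 := by simp [hc, hD0]
  have hn5 : c * d - 0 * 0 ≠ 0 := by simp [hd, hc]
  have e2 : toPGL (ofEntries a b c d h)
      = toPGL (matUpper a c hc * ofEntries 0 (-D) c d hn2) := by
    refine toPGL_eq_iff.mpr ⟨c, 1, hc, one_ne_zero, fun i j => ?_⟩
    rw [Submonoid.coe_mul, Matrix.mul_apply, Fin.sum_univ_two]
    fin_cases i <;> fin_cases j <;> simp [ofEntries, matUpper, hD] <;> ring
  have e4 : toPGL (ofEntries 0 (-D) c d hn2)
      = toPGL (ofEntries D 0 0 d hn3 * (matST * ofEntries c 0 0 d hn5)) := by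
    refine toPGL_eq_iff.mpr ⟨d, 1, hd, one_ne_zero, fun i j => ?_⟩
    simp only [Submonoid.coe_mul, Matrix.mul_apply, Fin.sum_univ_two]
    fin_cases i <;> fin_cases j <;> simp [ofEntries, matST] <;> ring
  exact (pglRep_eq_of_mul e2 core).trans
    (congrArg _ (pglRep_eq_of_mul_mul e4 rfl rfl))

lemma pglRep_diag_relation {γ : IntMat} (h10 : γ.1 1 0 = 0) (h01 : γ.1 0 1 = 0) :
    pglRep (toPGL γ) (pglRep (toPGL matTInv) core)
      = pglRep (toPGL γ) (pglRep (toPGL matST) core) + core :=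
  (congrArg _ pglRep_matTInv_core).trans
    ((pglRep_add _ _ _).trans (congrArg (_ + ·) (pglRep_diag_core h10 h01)))

/-- The fundamental relation behind the cocycle property. -/
lemma columnCocycle_second_column (a b c d : ℤ) (h : a * d - b * c ≠ 0) :
    columnCocycle b d = pglRep (toPGL (ofEntries a b c d h)) core + columnCocycle a c := by
  rcases eq_or_ne c 0 with rfl | hc
  -- For `c = 0` the matrix is itself upper triangular and the value at its first column, the point
  -- `∞`, is `0`.
  · have h1 : columnCocycle b d = _ := columnCocycle_of_upper (γ := ofEntries a b 0 d h) rfl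
    exact h1.trans ((add_zero _).symm.trans (congrArg (_ + ·) (columnCocycle_zero a).symm))
  refine Eq.trans ?_ (congrArg (_ + ·) (columnCocycle_of_ne a hc).symm)
  rcases eq_or_ne d 0 with rfl | hd
  · refine (columnCocycle_zero b).trans (Eq.symm ?_)
    refine Eq.trans (congrArg (· + _) (pglRep_of_second_eq_zero hc h)) ?_
    exact pglRep_add_eq_zero _ pglRep_matS_core
  · have hn : (a * d - b * c) * d - 0 * 0 ≠ 0 := by simp [h, hd]
    refine (columnCocycle_of_ne b hd).trans
      ((pglRep_second_upper hc hd rfl h hn).trans (Eq.symm ?_))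
    refine Eq.trans (congrArg (· + _) (pglRep_second_entries hc hd rfl h h hn)) ?_
    exact (pglRep_add _ _ _).symm.trans (congrArg _ (pglRep_diag_relation rfl rfl).symm)

/-- The cocycle `𝔷₀` on `PGL₂(ℚ)`. -/
noncomputable def rademacherCocycle (g : Matrix.ProjGenLinGroup (Fin 2) ℚ) : calD0 :=
  columnCocycle ((toPGL_surjective g).choose.1 0 0) ((toPGL_surjective g).choose.1 1 0)

lemma rademacherCocycle_toPGL (γ : IntMat) :
    rademacherCocycle (toPGL γ) = columnCocycle (γ.1 0 0) (γ.1 1 0) := by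
  obtain ⟨m, n, hm, hn, h⟩ := toPGL_eq_iff.mp (toPGL_surjective (toPGL γ)).choose_spec
  rw [rademacherCocycle, ← columnCocycle_mul _ _ hm, h, h, columnCocycle_mul _ _ hn]

lemma mul_matUpper (γ : IntMat) {a c : ℤ} (hc : c ≠ 0)
    (h : γ.1 0 0 * (γ.1 1 0 * a + γ.1 1 1 * c) - (γ.1 0 0 * a + γ.1 0 1 * c) * γ.1 1 0 ≠ 0) :
    γ * matUpper a c hc = ofEntries _ _ _ _ h := by
  apply Subtype.ext
  ext i j
  rw [Submonoid.coe_mul, Matrix.mul_apply, Fin.sum_univ_two]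
  fin_cases i <;> fin_cases j <;> simp [matUpper, ofEntries]

/-- If `δ` has first column `(a, c)` with `c ≠ 0`, then `γ · (1, a; 0, c)` has the first columns of
`γ` and of `γδ` as its columns, and `columnCocycle_second_column` applies to it. If `c = 0`, the
first columns of `γδ` and `γ` are proportional. -/
lemma rademacherCocycle_mul (g h : Matrix.ProjGenLinGroup (Fin 2) ℚ) :
    rademacherCocycle (g * h) = pglRep g (rademacherCocycle h) + rademacherCocycle g := by
  obtain ⟨γ, rfl⟩ := toPGL_surjective g
  obtain ⟨δ, rfl⟩ := toPGL_surjective h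
  rw [← toPGL_mul, rademacherCocycle_toPGL, rademacherCocycle_toPGL, rademacherCocycle_toPGL]
  have hm : ∀ i, (γ * δ).1 i 0 = γ.1 i 0 * δ.1 0 0 + γ.1 i 1 * δ.1 1 0 := fun i => by
    rw [Submonoid.coe_mul, Matrix.mul_apply, Fin.sum_univ_two]
  refine (congrArg₂ columnCocycle (hm 0) (hm 1)).trans ?_
  rcases eq_or_ne (δ.1 1 0) 0 with hδ | hδ
  · have h0 : δ.1 0 0 ≠ 0 := by
      intro h0
      apply IntMat.det_ne_zero δ
      rw [Matrix.det_fin_two, h0, hδ]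
      ring
    have hz : columnCocycle (δ.1 0 0) (δ.1 1 0) = 0 := hδ ▸ columnCocycle_zero _
    refine Eq.trans ?_ (pglRep_add_of_eq_zero _ hz _).symm
    refine Eq.trans (congrArg₂ columnCocycle ?_ ?_) (columnCocycle_mul (γ.1 0 0) (γ.1 1 0) h0)
    · rw [hδ, mul_zero, add_zero, mul_comm]
    · rw [hδ, mul_zero, add_zero, mul_comm]
  · have hu := columnCocycle_of_ne (δ.1 0 0) hδ
    have hdet : γ.1 0 0 * (γ.1 1 0 * δ.1 0 0 + γ.1 1 1 * δ.1 1 0)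
        - (γ.1 0 0 * δ.1 0 0 + γ.1 0 1 * δ.1 1 0) * γ.1 1 0 ≠ 0 := by
      have := mul_ne_zero (IntMat.det_ne_zero γ) hδ
      rw [Matrix.det_fin_two] at this
      convert this using 1
      ring
    refine (columnCocycle_second_column _ _ _ _ hdet).trans (congrArg (· + _) ?_)
    refine Eq.trans ?_ (congrArg (pglRep (toPGL γ)) hu).symm
    exact pglRep_eq_of_mul (congrArg toPGL (mul_matUpper γ hδ hdet).symm) core

lemma valueAt_rademacherCocycle (γ : IntMat) (x : Fin 2 → ℚ) (ω : IrrVec) :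
    valueAt (rademacherCocycle (toPGL γ)) x ω = zExplicit γ x ω := by
  rw [rademacherCocycle_toPGL]
  by_cases hc : γ.1 1 0 = 0
  · rw [zExplicit_of_eq_zero hc, columnCocycle, dif_pos hc]
    rfl
  · rw [zExplicit_of_ne_zero hc, columnCocycle, dif_neg hc, valueAt, pglRep_toPGL_val]
    exact matAct_upper_value (matUpper (γ.1 0 0) (γ.1 1 0) hc) rfl x ω

lemma rademacherCocycle_matS : rademacherCocycle (toPGL matS) = core := by
  rw [rademacherCocycle_toPGL]
  exact (columnCocycle_of_upper (γ := ofEntries 1 0 0 1 (by norm_num)) rfl).trans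
    (pglRep_diag_core rfl rfl)

end Cocycle

/-! ### Values at fixed points, nontriviality of the class, and zeta values. -/

section Values

lemma eigenvalue_ne_zero {γ : IntMat} {ω : IrrVec} {α : ℝ}
    (hα : (γ.1.map (Int.cast : ℤ → ℝ))ᵀ *ᵥ ω.1 = α • ω.1) : α ≠ 0 := by
  rintro rfl
  rw [zero_smul] at hα
  have h : (IrrVec.transposeMul γ ω).1 0 = 0 := congrFun hα 0
  exact (IrrVec.transposeMul γ ω).ne_zero 0 h

/-- The cocycle at a fixed point of a matrix of determinant one. -/
lemma valueAt_of_fixed {γ : IntMat} (x : Fin 2 → ℚ) {ω : IrrVec} {α : ℝ} (hdet : γ.1.det = 1)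
    (hα : (γ.1.map (Int.cast : ℤ → ℝ))ᵀ *ᵥ ω.1 = α • ω.1)
    (hx : ∃ m n : ℤ, α⁻¹ * (x 0 * ω.1 0 + x 1 * ω.1 1) - (x 0 * ω.1 0 + x 1 * ω.1 1)
      = m * ω.1 0 + n * ω.1 1) (hc : γ.1 1 0 ≠ 0) :
    valueAt (rademacherCocycle (toPGL γ)) x ω =
      ((γ.1 0 0 : ℝ) + γ.1 1 1) / (2 * γ.1 1 0) * bernBar2 (x 1)
        + Real.sign (γ.1 1 0) * dedekindRademacher (-γ.1 0 0) (γ.1 1 0) (fun i => (x i : ℝ))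
        - Real.sign (γ.1 1 0 * α) / 4 * indZ (x 0) * indZ (x 1) := by
  have hα0 := eigenvalue_ne_zero hα
  rw [valueAt_rademacherCocycle, zExplicit_of_ne_zero hc, columnValue]
  have e0 := congrFun hα 0
  have e1 := congrFun hα 1
  simp only [Matrix.mulVec, dotProduct, Fin.sum_univ_two, Matrix.transpose_apply,
    Matrix.map_apply, Pi.smul_apply, smul_eq_mul] at e0 e1
  have hgcd : Int.gcd (γ.1 0 0) (γ.1 1 0) = 1 := by
    rw [← Int.isCoprime_iff_gcd_eq_one]
    rw [Matrix.det_fin_two] at hdet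
    exact ⟨γ.1 1 1, -γ.1 0 1, by linear_combination hdet⟩
  have hdetr : (γ.1 0 0 : ℝ) * γ.1 1 1 - γ.1 0 1 * γ.1 1 0 = 1 := by
    rw [Matrix.det_fin_two] at hdet
    exact_mod_cast hdet
  rw [hgcd]
  have h0 := ω.ne_zero 0
  have h1 := ω.ne_zero 1
  have hcr : (γ.1 1 0 : ℝ) ≠ 0 := by exact_mod_cast hc
  obtain ⟨m, n, hmn⟩ := hx
  -- Since `α⁻¹ ω = (γᵀ)⁻¹ ω`, the hypothesis on `v` is a rational linear relation between `ω₁` and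
  -- `ω₂`. Its second coefficient gives `c x₁ - a x₂ ≡ -x₂` modulo `ℤ`, so both `bernBar2` values
  -- agree.
  have hlin := Fintype.linearIndependent_iff.mp ω.2
    ![(γ.1 1 1 : ℚ) * x 0 - γ.1 0 1 * x 1 - x 0 - m, -γ.1 1 0 * x 0 + γ.1 0 0 * x 1 - x 1 - n]
  have hBarg : -(γ.1 1 0 : ℝ) * x 0 + γ.1 0 0 * x 1 - x 1 = n := by
    have h2 := hlin (by
      simp only [Fin.sum_univ_two, Matrix.cons_val_zero, Matrix.cons_val_one, Rat.smul_def]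
      push_cast
      have k0 : α⁻¹ * ω.1 0 = γ.1 1 1 * ω.1 0 - γ.1 1 0 * ω.1 1 := by
        field_simp
        linear_combination (-ω.1 0) * hdetr + γ.1 1 1 * e0 - γ.1 1 0 * e1
      have k1 : α⁻¹ * ω.1 1 = -γ.1 0 1 * ω.1 0 + γ.1 0 0 * ω.1 1 := by
        field_simp
        linear_combination (-ω.1 1) * hdetr + γ.1 0 0 * e1 - γ.1 0 1 * e0
      linear_combination hmn - (x 0 : ℝ) * k0 - (x 1 : ℝ) * k1) 1
    simp only [Matrix.cons_val_one, Matrix.cons_val_fin_one] at h2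
    have h3 : -(γ.1 1 0 : ℚ) * x 0 + γ.1 0 0 * x 1 - x 1 = n := by linarith
    exact_mod_cast h3
  have hα' : (γ.1 0 0 : ℝ) + γ.1 1 0 * (ω.1 1 / ω.1 0) = α := by
    field_simp
    linarith
  have hB : bernBar2 ((γ.1 1 0 : ℝ) / ((1 : ℕ) : ℝ) * x 0 - γ.1 0 0 / ((1 : ℕ) : ℝ) * x 1)
      = bernBar2 (x 1) := by
    rw [Nat.cast_one, div_one, div_one, ← bernBar2_neg (x 1),
      ← bernBar2_periodic.sub_int_mul_eq n (x := -(x 1 : ℝ))]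
    congr 1
    rw [← hBarg]
    ring
  -- The characteristic equation turns `1/α + α`, the sum of the two `bernBar2` coefficients times
  -- `2c`, into the trace.
  have htr : α * α - (γ.1 0 0 + γ.1 1 1) * α + 1 = 0 := by
    have h3 : ω.1 0 * (α * α - (γ.1 0 0 + γ.1 1 1) * α + 1) = 0 := by
      linear_combination (-ω.1 0) * hdetr + (γ.1 1 1 - α) * e0 - γ.1 1 0 * e1
    exact (mul_eq_zero.mp h3).resolve_left h0
  rw [hα', hB]
  have e : ((1 : ℕ) : ℝ) ^ 2 / (2 * γ.1 1 0 * α) + α / (2 * γ.1 1 0)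
      = ((γ.1 0 0 : ℝ) + γ.1 1 1) / (2 * γ.1 1 0) := by
    push_cast
    field_simp
    linarith
  rw [← e]
  ring

lemma exists_rat_bernBar2 (q : ℚ) : ∃ r : ℚ, bernBar2 q = r :=
  ⟨Int.fract q ^ 2 - Int.fract q + 1 / 6, by rw [bernBar2, ← Rat.cast_fract]; push_cast; rfl⟩

lemma exists_rat_indZ (y : ℝ) : ∃ r : ℚ, indZ y = r := by
  rw [indZ_eq]
  split_ifs
  · exact ⟨1, by simp⟩
  · exact ⟨0, by simp⟩

lemma exists_rat_bernBar1 (q : ℚ) : ∃ r : ℚ, bernBar1 q = r := by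
  obtain ⟨r, hr⟩ := exists_rat_indZ q
  exact ⟨Int.fract q - 1 / 2 + r / 2, by rw [bernBar1_eq, hr, ← Rat.cast_fract]; push_cast; rfl⟩

lemma exists_rat_sign (y : ℝ) : ∃ r : ℚ, Real.sign y = r := by
  rcases Real.sign_apply_eq y with h | h | h <;> rw [h]
  · exact ⟨-1, by simp⟩
  · exact ⟨0, by simp⟩
  · exact ⟨1, by simp⟩

lemma exists_rat_dedekindRademacher (a c : ℤ) (x : Fin 2 → ℚ) :
    ∃ r : ℚ, dedekindRademacher a c (fun i => (x i : ℝ)) = r := by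
  choose f hf using exists_rat_bernBar1
  refine ⟨∑ m ∈ Finset.range c.natAbs,
    f (x 0 + (x 1 + m) * ((a : ℚ) / c)) * f ((x 1 + m) * (1 / (c : ℚ))), ?_⟩
  rw [dedekindRademacher]
  push_cast
  refine Finset.sum_congr rfl fun m _ => ?_
  rw [← hf, ← hf]
  push_cast
  rfl

lemma exists_rat_valueAt_of_fixed {γ : IntMat} (x : Fin 2 → ℚ) {ω : IrrVec} {α : ℝ}
    (hdet : γ.1.det = 1) (hα : (γ.1.map (Int.cast : ℤ → ℝ))ᵀ *ᵥ ω.1 = α • ω.1)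
    (hx : ∃ m n : ℤ, α⁻¹ * (x 0 * ω.1 0 + x 1 * ω.1 1) - (x 0 * ω.1 0 + x 1 * ω.1 1)
      = m * ω.1 0 + n * ω.1 1) :
    ∃ q : ℚ, valueAt (rademacherCocycle (toPGL γ)) x ω = q := by
  by_cases hc : γ.1 1 0 = 0
  · exact ⟨0, by rw [valueAt_rademacherCocycle, zExplicit_of_eq_zero hc, Rat.cast_zero]⟩
  · rw [valueAt_of_fixed x hdet hα hx hc]
    obtain ⟨b, hb⟩ := exists_rat_bernBar2 (x 1)
    obtain ⟨s, hs⟩ := exists_rat_sign (γ.1 1 0)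
    obtain ⟨s', hs'⟩ := exists_rat_sign (γ.1 1 0 * α)
    obtain ⟨t, ht⟩ := exists_rat_dedekindRademacher (-γ.1 0 0) (γ.1 1 0) x
    obtain ⟨d, hd⟩ := exists_rat_indZ (x 0)
    obtain ⟨d', hd'⟩ := exists_rat_indZ (x 1)
    rw [hb, hs, hs', ht, hd, hd']
    exact ⟨((γ.1 0 0 : ℚ) + γ.1 1 1) / (2 * γ.1 1 0) * b + s * t - s' / 4 * d * d', by push_cast; rfl⟩

/-- The obstruction is evaluation at `x = 0` and an eigenvector `ω` of `γᵀ` with positive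
eigenvalue: there `γ · v` and `v` agree for every `v`. -/
lemma rademacherCocycle_not_mem_coboundaries :
    rademacherCocycle ∉ groupCohomology.coboundaries₁ moduleD0 := by
  rintro ⟨v, hv⟩
  have hv' : ∀ g, rademacherCocycle g = pglRep g v - v := fun g => (congrFun hv g).symm
  have hli : LinearIndependent ℚ ![(1 : ℝ), √3 - 2] := by
    rw [Fintype.linearIndependent_iff]
    intro g hg
    have hirr : Irrational √3 := Nat.Prime.irrational_sqrt (p := 3) (by norm_num)
    simp only [Fin.sum_univ_two, Matrix.cons_val_zero, Matrix.cons_val_one, Rat.smul_def] at hg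
    have h1 : g 1 = 0 := by
      by_contra h1
      have h1' : (g 1 : ℝ) ≠ 0 := by exact_mod_cast h1
      apply hirr
      refine ⟨2 - g 0 / g 1, ?_⟩
      push_cast
      field_simp
      linarith
    rw [h1] at hg
    have h0 : g 0 = 0 := by simpa using hg
    intro i
    fin_cases i
    · exact h0
    · exact h1
  -- An eigenvector of the transpose of `(4, -1; 1, 0)` with eigenvalue `2 + √3`, since `(2 + √3)(√3
  -- - 2) = -1`.
  set ω : IrrVec := ⟨![1, √3 - 2], hli⟩
  set γ : IntMat := ofEntries 4 (-1) 1 0 (by norm_num)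
  have hdet : γ.1.det = 1 := by simp [γ, ofEntries, Matrix.det_fin_two]
  have h3 : √3 * √3 = 3 := Real.mul_self_sqrt (by norm_num)
  have hpos : 0 < 2 + √3 := by positivity
  have hα : (γ.1.map (Int.cast : ℤ → ℝ))ᵀ *ᵥ ω.1 = (2 + √3) • ω.1 := by
    funext i
    fin_cases i
    · simp [γ, ofEntries, ω, Matrix.mulVec, dotProduct, Fin.sum_univ_two]
      ring
    · simp [γ, ofEntries, ω, Matrix.mulVec, dotProduct, Fin.sum_univ_two]
      linarith
  have h1 := valueAt_of_fixed (γ := γ) 0 hdet hα ⟨0, 0, by simp⟩ (by simp [γ, ofEntries])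
  have hz : ∀ y : ℝ, y = 0 → indZ y = 1 ∧ bernBar1 y = 0 ∧ bernBar2 y = 1 / 6 := by
    rintro y rfl
    refine ⟨by simp [indZ_eq], by rw [bernBar1, if_pos ⟨0, by simp⟩], by simp [bernBar2]⟩
  have hS : dedekindRademacher (-4) 1 (fun i => (((0 : Fin 2 → ℚ) i : ℚ) : ℝ)) = 0 := by
    simp [dedekindRademacher, (hz 0 rfl).2.1]
  -- The trace term is `(4/2) · (1/6) = 1/3` and the sign term `1/4`.
  have h2 : valueAt (rademacherCocycle (toPGL γ)) 0 ω = 1 / 12 := by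
    rw [h1]
    have g00 : γ.1 0 0 = 4 := rfl
    have g10 : γ.1 1 0 = 1 := rfl
    have g11 : γ.1 1 1 = 0 := rfl
    rw [g00, g10, g11, hS]
    simp only [Pi.zero_apply, Rat.cast_zero, (hz 0 rfl).1, (hz 0 rfl).2.2]
    push_cast
    rw [one_mul (2 + √3), Real.sign_of_pos hpos]
    norm_num
  have h4 : valueAt (rademacherCocycle (toPGL γ)) 0 ω = 0 := by
    rw [hv']
    change ((pglRep (toPGL γ) v).1.1 (toQZ2 0) - v.1.1 (toQZ2 0)).1 ω = 0
    rw [pglRep_toPGL_val]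
    change (matAct γ v.1.1 (toQZ2 0)).1 ω - (v.1.1 (toQZ2 0)).1 ω = 0
    rw [matAct_unimodular_value γ hdet !![0, 1; -1, 4] (by
      ext i j; fin_cases i <;> fin_cases j <;> simp [γ, ofEntries])]
    have hr : rowMul !![0, 1; -1, 4] (toQZ2 0) = toQZ2 0 := by
      funext i
      fin_cases i <;> simp [rowMul, toQZ2]
    -- Elements of `𝒜₀` are invariant under positive scaling only, so the positivity of the
    -- eigenvalue is essential.
    have hω : IrrVec.transposeMul γ ω = IrrVec.scale hpos.ne' ω := Subtype.ext hα
    rw [hr, hω, (v.1.1 (toQZ2 0)).2 _ hpos ω, sub_self]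
  rw [h2] at h4
  norm_num at h4

lemma upperFract_spec (y : ℝ) : 0 < upperFract y ∧ upperFract y ≤ 1 ∧
    upperFract y = Int.fract y + indZ y := by
  have h := toIocMod_mem_Ioc (zero_lt_one : (0 : ℝ) < 1) 0 y
  rw [zero_add] at h
  refine ⟨h.1, h.2, ?_⟩
  rw [indZ_eq, upperFract]
  rw [toIocMod_eq_iff]
  split_ifs with h0
  · rw [h0]
    refine ⟨by norm_num, ⌊y⌋ - 1, ?_⟩
    have := Int.floor_add_fract y
    rw [h0] at this
    rw [zsmul_eq_mul]
    push_cast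
    linarith
  · refine ⟨⟨?_, ?_⟩, ⌊y⌋, ?_⟩
    · rw [add_zero]
      exact lt_of_le_of_ne (Int.fract_nonneg y) (Ne.symm h0)
    · have := Int.fract_lt_one y
      linarith
    · have := Int.floor_add_fract y
      rw [zsmul_eq_mul]
      linarith

/-- The distribution `core` in terms of values of zeta functions. -/
lemma valueAt_core_eq_zeta (x : Fin 2 → ℚ) {ω : IrrVec} (h0 : 0 < ω.1 0) (h1 : 0 < ω.1 1) :
    ((valueAt core x ω : ℝ) : ℂ) =
      barnesZeta2 (upperFract (x 0) * ω.1 0 + upperFract (x 1) * ω.1 1) ω.1 0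
        + (indZ (x 0) : ℂ) / 2 *
          HurwitzZeta.hurwitzZeta ((upperFract (x 1) : ℝ) : UnitAddCircle) 0
        + (indZ (x 1) : ℂ) / 2 *
          HurwitzZeta.hurwitzZeta ((upperFract (x 0) : ℝ) : UnitAddCircle) 0 := by
  obtain ⟨p0, q0, r0⟩ := upperFract_spec (x 0)
  obtain ⟨p1, q1, r1⟩ := upperFract_spec (x 1)
  rw [(barnesZeta2_spec (by positivity) h0 h1).2.2, hurwitzZeta_apply_zero p0 q0,
    hurwitzZeta_apply_zero p1 q1]
  have hx : x = ![x 0, x 1] := by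
    funext i
    fin_cases i <;> rfl
  have hv : valueAt core x ω = coreValue (toQZ2 ![x 0, x 1]) (ω.1 1 / ω.1 0) := by
    rw [← hx]; rfl
  rw [hv, coreValue_toQZ2, Real.sign_of_pos (div_pos h1 h0), r0, r1]
  simp only [bernBar1_eq, bernBar2]
  have hi : ∀ y : ℝ, indZ y * indZ y = indZ y ∧ Int.fract y * indZ y = 0 := by
    intro y
    rw [indZ_eq]
    split_ifs with h
    · simp [h]
    · simp
  obtain ⟨i0, j0⟩ := hi (x 0)
  obtain ⟨i1, j1⟩ := hi (x 1)
  generalize Int.fract (x 0 : ℝ) = u at *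
  generalize Int.fract (x 1 : ℝ) = v at *
  generalize indZ (x 0 : ℝ) = d at *
  generalize indZ (x 1 : ℝ) = e at *
  generalize ω.1 0 = a at *
  generalize ω.1 1 = b at *
  norm_cast
  have ha := h0.ne'
  have hb := h1.ne'
  -- Splitting according to the integrality of `x₁` and `x₂` leaves a rational identity in `u`, `v`,
  -- `ω₁`, `ω₂` in each of the four cases.
  have hd : d = 0 ∨ d = 1 ∧ u = 0 := by
    rcases mul_eq_zero.mp (show d * (d - 1) = 0 by linear_combination i0) with h | h
    · exact Or.inl h
    · have : d = 1 := by linarith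
      exact Or.inr ⟨this, by rwa [this, mul_one] at j0⟩
  have he : e = 0 ∨ e = 1 ∧ v = 0 := by
    rcases mul_eq_zero.mp (show e * (e - 1) = 0 by linear_combination i1) with h | h
    · exact Or.inl h
    · have : e = 1 := by linarith
      exact Or.inr ⟨this, by rwa [this, mul_one] at j1⟩
  rcases hd with rfl | ⟨rfl, rfl⟩ <;> rcases he with rfl | ⟨rfl, rfl⟩ <;> field_simp <;> ring

end Values

end RademacherCocycle

theorem theorem1 :
    ∃ 𝔷 : Matrix.ProjGenLinGroup (Fin 2) ℚ → calD0,
      (∀ (γ : IntMat) (x : Fin 2 → ℚ) (ω : IrrVec),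
        valueAt (𝔷 (toPGL γ)) x ω = zExplicit γ x ω) ∧
      (∃ h𝔷 : 𝔷 ∈ groupCohomology.cocycles₁ moduleD0,
        groupCohomology.H1π moduleD0 ⟨𝔷, h𝔷⟩ ≠ 0) ∧
      (∀ (x : Fin 2 → ℚ) (ω : IrrVec), 0 < ω.1 0 → 0 < ω.1 1 →
        let z : ℝ := upperFract (x 0) * ω.1 0 + upperFract (x 1) * ω.1 1
        IsBarnesZeta2 z ω.1 (barnesZeta2 z ω.1) ∧
        AnalyticAt ℂ (barnesZeta2 z ω.1) 0 ∧
        ((valueAt (𝔷 (toPGL matS)) x ω : ℝ) : ℂ) =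
          barnesZeta2 z ω.1 0
            + (indZ (x 0) : ℂ) / 2 *
              HurwitzZeta.hurwitzZeta ((upperFract (x 1) : ℝ) : UnitAddCircle) 0
            + (indZ (x 1) : ℂ) / 2 *
              HurwitzZeta.hurwitzZeta ((upperFract (x 0) : ℝ) : UnitAddCircle) 0) ∧
      (∀ (γ : IntMat) (hc : γ.1 1 0 ≠ 0),
        𝔷 (toPGL γ) = pglRep (toPGL (matUpper (γ.1 0 0) (γ.1 1 0) hc)) (𝔷 (toPGL matS))) ∧
      (∀ (γ : IntMat) (x : Fin 2 → ℚ) (ω : IrrVec) (α : ℝ), γ.1.det = 1 →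
        (γ.1.map (Int.cast : ℤ → ℝ))ᵀ *ᵥ ω.1 = α • ω.1 →
        (∃ m n : ℤ, α⁻¹ * (x 0 * ω.1 0 + x 1 * ω.1 1) - (x 0 * ω.1 0 + x 1 * ω.1 1)
          = m * ω.1 0 + n * ω.1 1) →
        (γ.1 1 0 ≠ 0 →
          valueAt (𝔷 (toPGL γ)) x ω =
            ((γ.1 0 0 : ℝ) + γ.1 1 1) / (2 * γ.1 1 0) * bernBar2 (x 1)
              + Real.sign (γ.1 1 0) *
                dedekindRademacher (-γ.1 0 0) (γ.1 1 0) (fun i => (x i : ℝ))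
              - Real.sign (γ.1 1 0 * α) / 4 * indZ (x 0) * indZ (x 1)) ∧
        ∃ q : ℚ, valueAt (𝔷 (toPGL γ)) x ω = q) := by
  refine ⟨rademacherCocycle, valueAt_rademacherCocycle,
    ⟨(groupCohomology.mem_cocycles₁_iff _).mpr rademacherCocycle_mul, fun h =>
      rademacherCocycle_not_mem_coboundaries ((groupCohomology.H1π_eq_zero_iff _).mp h)⟩,
    ?_, ?_, fun γ x ω α hdet hα hx => ⟨fun hc => valueAt_of_fixed x hdet hα hx hc,
      exists_rat_valueAt_of_fixed x hdet hα hx⟩⟩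
  · intro x ω h0 h1 z
    have hz : 0 < z :=
      add_pos (mul_pos (upperFract_spec _).1 h0) (mul_pos (upperFract_spec _).1 h1)
    refine ⟨(barnesZeta2_spec hz h0 h1).1, (barnesZeta2_spec hz h0 h1).2.1, ?_⟩
    rw [rademacherCocycle_matS]
    exact valueAt_core_eq_zeta x h0 h1
  · intro γ hc
    rw [rademacherCocycle_matS, rademacherCocycle_toPGL]
    exact columnCocycle_of_ne _ hc
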